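/- Let $G$ be a compact connected semisimple Lie group with Lie algebra $\mathfrak g$, let $\langle\cdot,\cdot\rangle$ be the negative of its Killing form, and let $M=G/H$ be a generalized flag manifold ($H$ the centralizer of a torus in $G$) with base point $p=eH$, endowed with an invariant Kähler structure. Equivalently, $M=\mathrm{Ad}(G)\xi\subset\mathfrak g$ is the adjoint orbit of some $\xi\in\mathfrak g$, $p=\xi$, $H$ is the isotropy group of $\xi$, the symplectic form is $\omega_q(X^*_q,Y^*_q)=\langle[X,Y],q\rangle$, where $X^*_q=[X,q]$ is the vector field induced by $X\in\mathfrak g$, and the metric is $g=\omega(\cdot,J\cdot)$, where $J$ is the invariant complex structure for which $g$ is Kähler: $J_q$ is multiplication by $i$ (resp. $-i$) on the $i\lambda$-eigenspaces of $\mathrm{ad}_q$ in $(T_qM)^{\mathbb C}\subset\mathfrak g^{\mathbb C}$ with $\lambda>0$ (resp. $\lambda<0$). Let $L$ be a compact (embedded, smooth) Lagrangian submanifold of $M$ through $p$. Denote by - $K$ the identity component of the stabilizer $\{g\in G: gL=L\}$; - $V\subset\Gamma(\nu L)$ the image of the linear map $\sigma:\mathfrak g\to\Gamma(\nu L)$,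 $X\mapsto (X^*|_L)^\perp$, where $\perp$ is the component normal to $L$ for the Kähler metric; - $\mathfrak h,\mathfrak k$ the Lie algebras of $H,K$, and $\mathfrak m$ the $\langle\cdot,\cdot\rangle$-orthogonal complement of $\mathfrak h$ in $\mathfrak g$, identified with $T_pM$ by $X\mapsto X^*_p$; - $\mathfrak l\subset\mathfrak m$ the subspace corresponding to $T_pL$, and $\mathfrak n=\{U\in\mathfrak h:[U,\mathfrak l]\subset\mathfrak l\}$ its normalizer in $\mathfrak h$. Then $$\dim V\ \ge\ \dim L+\dim\mathfrak h-\dim\mathfrak n .$$ Moreover, if equality holds, then $\mathfrak n\subset\mathfrak k\cap\mathfrak h$, and, if $L$ is connected, $K$ acts transitively on $L$. -/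

import Mathlib

open scoped Manifold ContDiff

noncomputable section

namespace FlagLagrangian

/-! ## Submanifolds of a normed space -/

/-- `S` is an embedded smooth submanifold of dimension `d` of the normed space `F`: near each of its
points a smooth diffeomorphism between open subsets of `F` straightens `S` to a `d`-dimensional
linear subspace. -/
def IsSmoothSubmanifold {F : Type*} [NormedAddCommGroup F] [NormedSpace ℝ F]
    (d : ℕ) (S : Set F) : Prop :=
  ∀ q ∈ S, ∃ (Φ : OpenPartialHomeomorph F F) (W : Submodule ℝ F),
    q ∈ Φ.source ∧ ContDiffOn ℝ ∞ Φ Φ.source ∧ ContDiffOn ℝ ∞ Φ.symm Φ.target ∧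
    Module.finrank ℝ W = d ∧ ∀ x ∈ Φ.source, x ∈ S ↔ Φ x ∈ W

/-! ## Lie groups

`G` is a real Lie group of dimension `N`; its Lie algebra is `GroupLieAlgebra (𝓡 N) G`, the tangent
space at `1` with the bracket of left-invariant vector fields. -/

instance instLEInftyMinSmoothness : ENat.LEInfty (minSmoothness ℝ 3) := by
  rw [minSmoothness_of_isRCLikeNormedField]
  infer_instance

/-- The Lie algebra `𝔤` of `G`. -/
abbrev LieAlg (N : ℕ) (G : Type*) [TopologicalSpace G] [ChartedSpace (EuclideanSpace ℝ (Fin N)) G]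
    [Group G] : Type :=
  GroupLieAlgebra (𝓡 N) G

section LieGroup

variable {N : ℕ} {G : Type*} [TopologicalSpace G] [ChartedSpace (EuclideanSpace ℝ (Fin N)) G]
  [Group G]

/-- The identification of `𝔤 = T₁G` with the model space. -/
def coord : LieAlg N G ≃L[ℝ] EuclideanSpace ℝ (Fin N) :=
  ContinuousLinearEquiv.refl ℝ (EuclideanSpace ℝ (Fin N))

instance instFiniteDimensionalLieAlg : FiniteDimensional ℝ (LieAlg N G) :=
  Module.Finite.equiv (coord (N := N) (G := G)).symm.toLinearEquiv

/-- The adjoint representation: `Ad g` is the differential at `1` of `x ↦ g x g⁻¹`. -/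
def Ad (g : G) : LieAlg N G →L[ℝ] LieAlg N G :=
  mfderiv (𝓡 N) (𝓡 N) (fun x : G => g * x * g⁻¹) 1

theorem Ad_one (X : LieAlg N G) : Ad (1 : G) X = X := by
  have : (fun x : G => 1 * x * 1⁻¹) = id := by ext; simp
  unfold Ad
  rw [this, mfderiv_id]
  rfl

/-- The curve `γ` in `G` passes through `1` at time `0` with velocity `X`. -/
def HasVelocity (γ : ℝ → G) (X : LieAlg N G) : Prop :=
  γ 0 = 1 ∧ HasMFDerivAt 𝓘(ℝ, ℝ) (𝓡 N) γ 0
    (ContinuousLinearMap.toSpanSingleton ℝ (X : EuclideanSpace ℝ (Fin N)))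

theorem HasVelocity.smul {γ : ℝ → G} {X : LieAlg N G}
    (hγ : HasVelocity γ X) (c : ℝ) :
    HasVelocity (fun t => γ (c * t)) (c • X) := by
  refine ⟨by simp [hγ.1], ?_⟩
  have h1 : HasMFDerivAt 𝓘(ℝ, ℝ) 𝓘(ℝ, ℝ) (fun t : ℝ => c * t) 0
      (ContinuousLinearMap.toSpanSingleton ℝ c) := by
    have : HasDerivAt (fun t : ℝ => c * t) c 0 := by simpa using (hasDerivAt_id (0 : ℝ)).const_mul c
    exact this.hasFDerivAt.hasMFDerivAt
  have hc := HasMFDerivAt.comp (x := (0 : ℝ)) (f := fun t : ℝ => c * t) (g := γ)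
    (g' := ContinuousLinearMap.toSpanSingleton ℝ (X : EuclideanSpace ℝ (Fin N)))
    (by rw [mul_zero]; exact hγ.2) h1
  refine hc.congr_mfderiv (ContinuousLinearMap.ext fun (t : ℝ) => ?_)
  change (t • c) • (X : EuclideanSpace ℝ (Fin N)) = t • (c • (X : EuclideanSpace ℝ (Fin N)))
  rw [smul_eq_mul, mul_smul]

variable [LieGroup (𝓡 N) ∞ G]

theorem contMDiff_conj (g : G) : ContMDiff (𝓡 N) (𝓡 N) ∞ (fun x : G => g * x * g⁻¹) :=
  (contMDiff_mul_right (I := 𝓡 N) (a := g⁻¹)).comp (contMDiff_mul_left (I := 𝓡 N) (a := g))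

theorem Ad_mul (g h : G) (X : LieAlg N G) : Ad (g * h) X = Ad g (Ad h X) := by
  have e : (fun x : G => g * h * x * (g * h)⁻¹)
      = (fun x : G => g * x * g⁻¹) ∘ (fun x : G => h * x * h⁻¹) := by
    ext x; simp [mul_assoc]
  unfold Ad
  have hg := ((contMDiff_conj (N := N) g).mdifferentiableAt (x := 1) (by simp)).hasMFDerivAt
  have hh := ((contMDiff_conj (N := N) h).mdifferentiableAt (x := 1) (by simp)).hasMFDerivAt
  have h1 : h * 1 * h⁻¹ = 1 := by simp
  have hc := HasMFDerivAt.comp (x := (1 : G)) (f := fun x : G => h * x * h⁻¹)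
    (g := fun x : G => g * x * g⁻¹)
    (g' := (mfderiv (𝓡 N) (𝓡 N) (fun x : G => g * x * g⁻¹) 1 :)) (by rw [h1]; exact hg) hh
  rw [e, hc.mfderiv]
  rfl

theorem HasVelocity.mul {γ δ : ℝ → G} {X Y : LieAlg N G}
    (hγ : HasVelocity γ X) (hδ : HasVelocity δ Y) :
    HasVelocity (fun t => γ t * δ t) (X + Y) := by
  refine ⟨by simp [hγ.1, hδ.1], ?_⟩
  have hm := ((contMDiff_mul (𝓡 N) ∞ (G := G)).mdifferentiableAt (x := ((1 : G), (1 : G)))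
    (by simp))
  have hc := HasMFDerivAt.comp (x := (0 : ℝ)) (f := fun t => (γ t, δ t))
    (g := fun p : G × G => p.1 * p.2)
    (g' := (mfderiv ((𝓡 N).prod (𝓡 N)) (𝓡 N) (fun p : G × G => p.1 * p.2) (1, 1) :))
    (by rw [hγ.1, hδ.1]; exact hm.hasMFDerivAt) (hγ.2.prodMk hδ.2)
  refine hc.congr_mfderiv (ContinuousLinearMap.ext fun (t : ℝ) => ?_)
  have hs := mfderiv_prod_eq_add_apply (I := 𝓡 N) (I' := 𝓡 N) (I'' := 𝓡 N) hm
    (v := (((t • X : LieAlg N G), (t • Y : LieAlg N G)) :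
      EuclideanSpace ℝ (Fin N) × EuclideanSpace ℝ (Fin N)))
  have e1 : mfderiv (𝓡 N) (𝓡 N) (fun z : G => z * 1) 1 = ContinuousLinearMap.id ℝ _ :=
    ((hasMFDerivAt_id (I := 𝓡 N) (1 : G)).congr_of_eventuallyEq
      (.of_forall fun z => mul_one z)).mfderiv
  have e2 : mfderiv (𝓡 N) (𝓡 N) (fun z : G => 1 * z) 1 = ContinuousLinearMap.id ℝ _ :=
    ((hasMFDerivAt_id (I := 𝓡 N) (1 : G)).congr_of_eventuallyEq
      (.of_forall fun z => one_mul z)).mfderiv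
  have hs' := hs.trans (congrArg₂ (fun (a b : LieAlg N G →L[ℝ] LieAlg N G) =>
    a (t • X) + b (t • Y)) e1 e2)
  refine hs'.trans ?_
  exact (smul_add (A := EuclideanSpace ℝ (Fin N)) t X Y).symm

/-- The Lie algebra of a closed subgroup `K` of `G`: the tangent space of `K` at `1`, that is, the
set of initial velocities of curves in `K` issuing from `1`. -/
def lieAlgOf (N : ℕ) {G : Type*} [TopologicalSpace G]
    [ChartedSpace (EuclideanSpace ℝ (Fin N)) G] [Group G] [LieGroup (𝓡 N) ∞ G] (K : Subgroup G) : Submodule ℝ (LieAlg N G) where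
  carrier := {X | ∃ γ : ℝ → G, (∀ t, γ t ∈ K) ∧ HasVelocity γ X}
  zero_mem' := ⟨fun _ => 1, fun _ => K.one_mem, rfl, by
    have := hasMFDerivAt_const (I := 𝓘(ℝ, ℝ)) (I' := 𝓡 N) (1 : G) (0 : ℝ)
    refine this.congr_mfderiv (ContinuousLinearMap.ext fun (t : ℝ) => ?_)
    exact (smul_zero (A := EuclideanSpace ℝ (Fin N)) (t : ℝ)).symm⟩
  add_mem' := by
    rintro X Y ⟨γ, hγ, h⟩ ⟨δ, hδ, h'⟩
    exact ⟨_, fun t => K.mul_mem (hγ t) (hδ t), h.mul h'⟩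
  smul_mem' := by
    rintro c X ⟨γ, hγ, h⟩
    exact ⟨_, fun t => hγ (c * t), h.smul c⟩

/-- The isotropy subgroup of `ξ ∈ 𝔤` under the adjoint action. For `G` compact and connected it is
the centralizer in `G` of the torus generated by `ξ`, and all centralizers of tori are of this
form. -/
def isotropy (ξ : LieAlg N G) : Subgroup G where
  carrier := {g | Ad g ξ = ξ}
  one_mem' := Ad_one ξ
  mul_mem' := by
    intro g h hg hh
    change Ad (g * h) ξ = ξ
    rw [Ad_mul, show Ad h ξ = ξ from hh, show Ad g ξ = ξ from hg]
  inv_mem' := by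
    intro g hg
    have h : Ad (g⁻¹ * g) ξ = ξ := by rw [inv_mul_cancel, Ad_one]
    rwa [Ad_mul, show Ad g ξ = ξ from hg] at h

/-- The stabilizer in `G` of a subset `L` of `𝔤` under the adjoint action. -/
def setStabilizer (L : Set (LieAlg N G)) : Subgroup G where
  carrier := {g | (fun q => Ad g q) '' L = L}
  one_mem' := by simp [Ad_one]
  mul_mem' := by
    intro g h hg hh
    change (fun q => Ad (g * h) q) '' L = L
    have : (fun q => Ad (g * h) q) '' L = (fun q => Ad g q) '' ((fun q => Ad h q) '' L) := by
      rw [Set.image_image]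
      exact Set.image_congr fun q _ => Ad_mul g h q
    rw [this, show (fun q => Ad h q) '' L = L from hh]
    exact hg
  inv_mem' := by
    intro g hg
    change (fun q => Ad g⁻¹ q) '' L = L
    conv_lhs => rw [← show (fun q => Ad g q) '' L = L from hg]
    rw [Set.image_image]
    simp [← Ad_mul, Ad_one]

/-- `K`: the identity component of the stabilizer of `L` in `G`. -/
def stabComponent (L : Set (LieAlg N G)) : Subgroup G :=
  haveI : IsTopologicalGroup G := topologicalGroup_of_lieGroup (𝓡 N) ∞
  (Subgroup.connectedComponentOfOne (setStabilizer L)).map (setStabilizer L).subtype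

/-! ## The flag manifold `M = Ad(G)ξ ≅ G/H` and its invariant Kähler structure -/

/-- The generalized flag manifold `M = G/H`, `H = isotropy ξ`, realized as the adjoint orbit of
`ξ`; the base point `p = eH` corresponds to `ξ`. -/
def flagManifold (ξ : LieAlg N G) : Set (LieAlg N G) := {q | ∃ g : G, q = Ad g ξ}

/-- The value at `q` of the vector field `X^*` on `M` induced by `X ∈ 𝔤`. -/
def fundamentalField (X q : LieAlg N G) : LieAlg N G := ⁅X, q⁆

/-- `T_qM ⊆ 𝔤` for `q` in an adjoint orbit `M`: all values `X^*_q`, `X ∈ 𝔤`. -/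
def tangentM (q : LieAlg N G) : Submodule ℝ (LieAlg N G) :=
  LinearMap.range (LieAlgebra.ad ℝ (LieAlg N G) q)

theorem mem_tangentM {q v : LieAlg N G} : v ∈ tangentM q ↔ ∃ X, fundamentalField X q = v := by
  constructor
  · rintro ⟨X, rfl⟩
    exact ⟨-X, by simp [fundamentalField]⟩
  · rintro ⟨X, rfl⟩
    exact ⟨-X, by simp [fundamentalField]⟩

/-- `⟨X, Y⟩`: the negative of the Killing form of `𝔤`. -/
def ip (X Y : LieAlg N G) : ℝ := -killingForm ℝ (LieAlg N G) X Y

theorem ip_lie (X Y Z : LieAlg N G) : ip ⁅X, Y⁆ Z = ip X ⁅Y, Z⁆ := by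
  unfold ip
  rw [LieModule.traceForm_apply_lie_apply]

/-- The invariant symplectic form of `M`: `ω_q(X^*_q, Y^*_q) = ⟨[X, Y], q⟩`. The chosen
preimages do not matter, see `omega_fundamentalField`. -/
def omega (q v w : LieAlg N G) : ℝ :=
  ip ⁅Classical.epsilon fun X => fundamentalField X q = v,
    Classical.epsilon fun Y => fundamentalField Y q = w⁆ q

theorem omega_fundamentalField (q X Y : LieAlg N G) :
    omega q (fundamentalField X q) (fundamentalField Y q) = ip ⁅X, Y⁆ q := by
  unfold omega
  have hX := Classical.epsilon_spec (p := fun Z => fundamentalField Z q = fundamentalField X q)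
    ⟨X, rfl⟩
  have hY := Classical.epsilon_spec (p := fun Z => fundamentalField Z q = fundamentalField Y q)
    ⟨Y, rfl⟩
  set X' := Classical.epsilon fun Z => fundamentalField Z q = fundamentalField X q
  set Y' := Classical.epsilon fun Z => fundamentalField Z q = fundamentalField Y q
  unfold fundamentalField at hX hY
  have skew : ∀ A B : LieAlg N G, ip ⁅A, B⁆ q = - ip ⁅B, A⁆ q := by
    intro A B
    rw [← lie_skew A B]
    simp only [ip, map_neg, LinearMap.neg_apply]
  rw [ip_lie, hY, ← ip_lie, skew, ip_lie, hX, ← ip_lie, ← skew]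

theorem omega_eq_ip {q v w : LieAlg N G} (hw : w ∈ tangentM q) :
    omega q v w = ip (Classical.epsilon fun X => fundamentalField X q = v) w := by
  unfold omega
  rw [ip_lie]
  exact congrArg _ (Classical.epsilon_spec (p := fun Y => fundamentalField Y q = w)
    (mem_tangentM.1 hw))

/-- The invariant complex structure `J_q` on `T_qM ⊆ 𝔤` for which `ω(·, J·)` is a Kähler metric.
In the complexification, `ad q` has purely imaginary eigenvalues `iλ`, and `J_q` is `± i` on the
`iλ`-eigenspace according to the sign of `λ ≠ 0`; for `q = ξ`, the root space of a root `α` lies in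
the eigenspace with `λ = α(-iξ)`, so that `J_ξ` is the complex structure of the `T`-chamber
containing `-iξ`. In real terms `J_q = λ⁻¹ ad q` on the `(-λ²)`-eigenspace of `(ad q)²`, `λ > 0`,
see `complexStructure_apply`. -/
def complexStructure (q : LieAlg N G) : Module.End ℝ (LieAlg N G) :=
  let A : Module.End ℝ (LieAlg N G) := LieAlgebra.ad ℝ (LieAlg N G) q
  A * Polynomial.aeval (A * A)
    (Lagrange.interpolate (minpoly ℝ (A * A)).roots.toFinset id fun μ => (Real.sqrt (-μ))⁻¹)

theorem complexStructure_apply {q v : LieAlg N G} {l : ℝ} (hl : 0 < l)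
    (hv : ⁅q, ⁅q, v⁆⁆ = -(l ^ 2) • v) : complexStructure q v = l⁻¹ • ⁅q, v⁆ := by
  by_cases h0 : v = 0
  · simp [h0]
  set A : Module.End ℝ (LieAlg N G) := LieAlgebra.ad ℝ (LieAlg N G) q with hA
  have he : Module.End.HasEigenvector (A * A) (-(l ^ 2)) v :=
    ⟨Module.End.mem_eigenspace_iff.2 (by simpa [hA] using hv), h0⟩
  have hr : -(l ^ 2) ∈ (minpoly ℝ (A * A)).roots.toFinset := by
    rw [Multiset.mem_toFinset, Polynomial.mem_roots
      (minpoly.ne_zero (Algebra.IsIntegral.isIntegral (R := ℝ) (A * A)))]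
    exact Module.End.isRoot_of_hasEigenvalue (Module.End.hasEigenvalue_of_hasEigenvector he)
  change A (Polynomial.aeval (A * A) _ v) = _
  rw [Module.End.aeval_apply_of_hasEigenvector he]
  have := Lagrange.eval_interpolate_at_node (r := fun μ => (Real.sqrt (-μ))⁻¹) (v := id)
    (Function.injective_id.injOn) hr
  simp only [id_eq, neg_neg, Real.sqrt_sq hl.le] at this
  rw [this, map_smul]
  rfl

/-- The invariant Kähler metric `g_q = ω_q(·, J_q ·)` on `T_qM`. -/
def kahlerMetric (q v w : LieAlg N G) : ℝ := omega q v (complexStructure q w)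

/-! ## Lagrangian submanifolds -/

/-- The tangent space `T_qL ⊆ 𝔤` of a submanifold `L ⊆ 𝔤`, spanned by (and in fact equal to the
set of) the velocities at `q` of curves in `L`. -/
def tangentL (L : Set (LieAlg N G)) (q : LieAlg N G) : Submodule ℝ (LieAlg N G) :=
  Submodule.span ℝ {v | ∃ γ : ℝ → LieAlg N G, γ 0 = q ∧ (∀ t, γ t ∈ L) ∧
    HasDerivAt (fun t => coord (γ t)) (coord v) 0}

/-- `L` is a compact embedded Lagrangian submanifold, of dimension `d`, of `M = Ad(G)ξ`. -/
structure IsCompactLagrangian (ξ : LieAlg N G) (d : ℕ) (L : Set (LieAlg N G)) : Prop where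
  subset : L ⊆ flagManifold ξ
  isCompact : IsCompact L
  isSmoothSubmanifold : IsSmoothSubmanifold d (coord '' L)
  isotropic : ∀ q ∈ L, ∀ v ∈ tangentL L q, ∀ w ∈ tangentL L q, omega q v w = 0
  finrank_eq : ∀ q ∈ L, Module.finrank ℝ (tangentM q) = 2 * d

/-- `w ∈ ν_qL`: the vector `w ∈ T_qM` is orthogonal to `T_qL` for the Kähler metric. -/
def IsNormal (L : Set (LieAlg N G)) (q w : LieAlg N G) : Prop :=
  w ∈ tangentM q ∧ ∀ v ∈ tangentL L q, kahlerMetric q v w = 0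

theorem kahlerMetric_eq_ip (q v w : LieAlg N G) : kahlerMetric q v w =
    ip (Classical.epsilon fun X => fundamentalField X q = v) (complexStructure q w) :=
  omega_eq_ip ⟨_, rfl⟩

theorem IsNormal.zero (L : Set (LieAlg N G)) (q : LieAlg N G) : IsNormal L q 0 :=
  ⟨Submodule.zero_mem _, fun v _ => by simp [kahlerMetric_eq_ip, ip]⟩

theorem IsNormal.add {L : Set (LieAlg N G)} {q w w' : LieAlg N G} (h : IsNormal L q w)
    (h' : IsNormal L q w') : IsNormal L q (w + w') :=
  ⟨Submodule.add_mem _ h.1 h'.1, fun v hv => by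
    have h1 := h.2 v hv
    have h2 := h'.2 v hv
    rw [kahlerMetric_eq_ip] at h1 h2 ⊢
    unfold ip at h1 h2 ⊢
    rw [map_add, map_add, neg_add, h1, h2, add_zero]⟩

theorem IsNormal.smul {L : Set (LieAlg N G)} {q w : LieAlg N G} (c : ℝ) (h : IsNormal L q w) :
    IsNormal L q (c • w) :=
  ⟨Submodule.smul_mem _ c h.1, fun v hv => by
    have h1 := h.2 v hv
    rw [kahlerMetric_eq_ip] at h1 ⊢
    unfold ip at h1 ⊢
    rw [map_smul, map_smul, ← smul_neg, h1, smul_zero]⟩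

/-- `s = σ(X)`: the section `s` of the normal bundle `νL` is the normal component `(X^*|_L)^⊥`. -/
def IsSigma (L : Set (LieAlg N G)) (X : LieAlg N G) (s : L → LieAlg N G) : Prop :=
  ∀ q : L, IsNormal L q (s q) ∧ fundamentalField X q - s q ∈ tangentL L q

/-- The space `V ⊆ Γ(νL)`: the image of `σ : X ↦ (X^*|_L)^⊥`. -/
def spaceV (L : Set (LieAlg N G)) : Submodule ℝ (L → LieAlg N G) where
  carrier := {s | ∃ X : LieAlg N G, IsSigma L X s}
  zero_mem' := ⟨0, fun q => ⟨IsNormal.zero L q, by simp [fundamentalField]⟩⟩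
  add_mem' := by
    rintro s t ⟨X, hX⟩ ⟨Y, hY⟩
    refine ⟨X + Y, fun q => ⟨(hX q).1.add (hY q).1, ?_⟩⟩
    have := Submodule.add_mem _ (hX q).2 (hY q).2
    rwa [sub_add_sub_comm, fundamentalField, fundamentalField, ← add_lie] at this
  smul_mem' := by
    rintro c s ⟨X, hX⟩
    refine ⟨c • X, fun q => ⟨(hX q).1.smul c, ?_⟩⟩
    have := Submodule.smul_mem _ c (hX q).2
    rwa [smul_sub, fundamentalField, ← smul_lie] at this

/-- `𝔪`: the orthogonal complement of `𝔥` in `𝔤`. -/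
def spaceM (ξ : LieAlg N G) : Submodule ℝ (LieAlg N G) :=
  (killingForm ℝ (LieAlg N G)).orthogonal (lieAlgOf N (isotropy ξ))

/-- `𝔩`: the subspace of `𝔪` corresponding to `T_pL` under `𝔪 ≅ T_pM`, `X ↦ X^*_p`, `p = ξ`. -/
def spaceL (ξ : LieAlg N G) (L : Set (LieAlg N G)) : Submodule ℝ (LieAlg N G) :=
  spaceM ξ ⊓ (tangentL L ξ).comap (-(LieAlgebra.ad ℝ (LieAlg N G) ξ))

theorem mem_spaceL {ξ X : LieAlg N G} {L : Set (LieAlg N G)} :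
    X ∈ spaceL ξ L ↔ X ∈ spaceM ξ ∧ fundamentalField X ξ ∈ tangentL L ξ := by
  simp only [spaceL, fundamentalField, Submodule.mem_inf, Submodule.mem_comap,
    LinearMap.neg_apply, LieAlgebra.ad_apply, lie_skew]

/-- `𝔫`: the normalizer of `𝔩` in `𝔥`. -/
def normalizerL (ξ : LieAlg N G) (L : Set (LieAlg N G)) : Submodule ℝ (LieAlg N G) where
  carrier := {U | U ∈ lieAlgOf N (isotropy ξ) ∧ ∀ X ∈ spaceL ξ L, ⁅U, X⁆ ∈ spaceL ξ L}
  zero_mem' := ⟨Submodule.zero_mem _, fun X _ => by simp⟩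
  add_mem' := by
    rintro U W ⟨hU, hU'⟩ ⟨hW, hW'⟩
    exact ⟨Submodule.add_mem _ hU hW, fun X hX => by
      rw [add_lie]; exact Submodule.add_mem _ (hU' X hX) (hW' X hX)⟩
  smul_mem' := by
    rintro c U ⟨hU, hU'⟩
    exact ⟨Submodule.smul_mem _ c hU, fun X hX => by
      rw [smul_lie]; exact Submodule.smul_mem _ c (hU' X hX)⟩

end LieGroup
end FlagLagrangian

end

/-!
The kernel of `σ : 𝔤 → Γ(νL)` consists of the `X` whose induced field `X^*` is tangent to `L`
(`tangentAlg L`), so `dim V = dim 𝔤 - dim ker σ` (`finrank_spaceV_add`). Rank-nullity for the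
evaluation `X ↦ X^*_ξ` on `ker σ` gives `dim ker σ ≤ dim L + dim (ker σ ∩ 𝔥)`, because its image
lies in `T_ξL` (`finrank_tangentAlg`, `finrank_range_evalTangent_le`). An element of `ker σ ∩ 𝔥`
generates a flow which preserves `L` and fixes `ξ`; it therefore preserves `T_ξL`, so that
`ker σ ∩ 𝔥 ⊆ 𝔫` (`inf_le_normalizerL`). Together with `dim 𝔤 = 2 dim L + dim 𝔥` this is the inequality.

If equality holds, then `ker σ ∩ 𝔥 = 𝔫` and the evaluation maps `ker σ` onto a space of dimension
`dim L`. As the flow of an element of `ker σ` consists of elements of `K`, `ker σ ⊆ 𝔨`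
(`tangentAlg_le`), which gives `𝔫 ⊆ 𝔨 ∩ 𝔥`. By the inverse function theorem the orbit `Kξ` is a
neighbourhood of `ξ` in `L` (`orbit_mem_nhdsWithin`); being homogeneous it is open in `L`, and it is
compact since `K` is closed, so `Kξ = L` if `L` is connected (`exists_stabComponent_eq`).

Several standard facts are established on the way.

* The differential of `Ad` is `ad` (`hasFDerivAt_AdE_symm`). In a chart at `1` the group law `F` and
  the conjugation `C` satisfy `F (C (x, y), x) = F (x, y)`, and differentiating this identity twice
  expresses the mixed second derivative of `C` by that of `F`, which also computes the bracket of
  left-invariant fields.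
* One-parameter subgroups act on `𝔤` by `exp (t ad X)` (`exists_oneParameter`). In particular the
  fundamental fields are linear fields on `𝔤`, and a closed submanifold is invariant under the flow
  of a linear field tangent to it (`IsSmoothSubmanifold.exp_mem`).
* The negative of the Killing form is positive definite (`ip_pos`): for an `Ad`-invariant inner
  product, obtained by averaging, `ad X` is skew, so that `tr (ad X)² < 0` for `X ≠ 0`.
* `T_qL ⊆ T_qM` when the two spaces are defined by velocities of curves and by fundamental fields,
  respectively (`tangentL_le_tangentM`): along a curve in an adjoint orbit, the operators `ad` are
  annihilated by a common separable polynomial, which forces the velocity to be orthogonal to the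
  centralizer of `q` (`trace_deriv_mul_eq_zero`).
* The Kähler metric is `⟨v, (-(ad q)²)^{-1/2} w⟩` on `T_qM` (`kahlerMetric_eq_sqrtInv`), hence is
  positive definite (`metricForm_pos`); this makes the normal component, and thus `σ`, well defined.
-/

noncomputable section

namespace FlagLagrangian

open Set Filter Topology

/-! ### Second-order calculus of a local group law -/

section LocalGroup

variable {E : Type*} [NormedAddCommGroup E] [NormedSpace ℝ E]

theorem hasFDerivAt_partial_right {F : E × E → E} {x e : E} (hF : DifferentiableAt ℝ F (x, e)) :
    HasFDerivAt (fun y => F (x, y)) ((fderiv ℝ F (x, e)).comp (ContinuousLinearMap.inr ℝ E E)) e :=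
  HasFDerivAt.comp (f := fun y => (x, y)) e hF.hasFDerivAt (hasFDerivAt_prodMk_right x e)

theorem hasFDerivAt_partial_left {F : E × E → E} {x e : E} (hF : DifferentiableAt ℝ F (e, x)) :
    HasFDerivAt (fun y => F (y, x)) ((fderiv ℝ F (e, x)).comp (ContinuousLinearMap.inl ℝ E E)) e :=
  HasFDerivAt.comp (f := fun y => (y, x)) e hF.hasFDerivAt (hasFDerivAt_prodMk_left e x)

theorem eventually_differentiableAt_prod {F : E × E → E} {e : E} (hF : ContDiffAt ℝ 2 F (e, e)) :
    ∀ᶠ p in 𝓝 (e, e), DifferentiableAt ℝ F p := by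
  filter_upwards [hF.eventually (by simp)] with p hp
  exact hp.differentiableAt (by simp)

/-- The second partial derivative along `{e}`, as a function of the first variable. -/
theorem hasFDerivAt_partial_right_along {F : E × E → E} {e : E} (hF : ContDiffAt ℝ 2 F (e, e))
    (v : E) :
    HasFDerivAt (fun x => fderiv ℝ (fun y => F (x, y)) e v)
      (((fderiv ℝ (fderiv ℝ F) (e, e)).flip (0, v)).comp (ContinuousLinearMap.inl ℝ E E)) e := by
  have h2 : HasFDerivAt (fderiv ℝ F) (fderiv ℝ (fderiv ℝ F) (e, e)) (e, e) :=
    ((hF.fderiv_right (m := 1) (by norm_num)).differentiableAt (by simp)).hasFDerivAt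
  have h3 := (h2.comp (f := fun x : E => (x, e)) e (hasFDerivAt_prodMk_left e e)).clm_apply
    (hasFDerivAt_const ((0 : E), v) e)
  have hc : Tendsto (fun x : E => (x, e)) (𝓝 e) (𝓝 (e, e)) :=
    (Continuous.prodMk_left e).continuousAt
  refine (h3.congr_of_eventuallyEq ?_).congr_fderiv ?_
  · filter_upwards [hc.eventually (eventually_differentiableAt_prod hF)] with x hx
    rw [(hasFDerivAt_partial_right hx).fderiv]
    simp
  · ext w
    simp

/-- The infinitesimal form of the group law: if `F` is a multiplication with unit `e` and
`C (x, y)` is the conjugate of `y` by `x`, then the derivative at `e` of `x ↦ ∂₂C (x, e)` is the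
antisymmetrization of the mixed second derivative of `F`. -/
theorem hasFDerivAt_conj_of_mul {F C : E × E → E} {e : E}
    (hF : ContDiffAt ℝ 2 F (e, e)) (hC : ContDiffAt ℝ 2 C (e, e))
    (hF1 : ∀ᶠ x in 𝓝 e, F (x, e) = x) (hF2 : ∀ᶠ x in 𝓝 e, F (e, x) = x)
    (hC1 : ∀ᶠ x in 𝓝 e, C (x, e) = e)
    (hFC : ∀ᶠ p in 𝓝 (e, e), F (C p, p.1) = F p) (v w : E) :
    fderiv ℝ (fun x => fderiv ℝ (fun y => C (x, y)) e v) e w =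
      fderiv ℝ (fun x => fderiv ℝ (fun y => F (x, y)) e v) e w -
        fderiv ℝ (fun x => fderiv ℝ (fun y => F (x, y)) e w) e v := by
  have dF : DifferentiableAt ℝ F (e, e) := hF.differentiableAt (by simp)
  have hl : ∀ u, fderiv ℝ F (e, e) (u, 0) = u := by
    intro u
    have h1 := (hasFDerivAt_partial_left dF).unique
      ((hasFDerivAt_id e).congr_of_eventuallyEq hF1)
    simpa using DFunLike.congr_fun h1 u
  have hr : ∀ u, fderiv ℝ F (e, e) (0, u) = u := by
    intro u
    have h1 := (hasFDerivAt_partial_right dF).unique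
      ((hasFDerivAt_id e).congr_of_eventuallyEq hF2)
    simpa using DFunLike.congr_fun h1 u
  have hc : Tendsto (fun x : E => (x, e)) (𝓝 e) (𝓝 (e, e)) :=
    (Continuous.prodMk_left e).continuousAt
  have hc' : Tendsto (fun x : E => (e, x)) (𝓝 e) (𝓝 (e, e)) :=
    (Continuous.prodMk_right e).continuousAt
  -- differentiate `F (C (x, y), x) = F (x, y)` in `y` at `e`
  have key : ∀ᶠ x in 𝓝 e, fderiv ℝ F (e, x) (fderiv ℝ (fun y => C (x, y)) e v, 0) =
      fderiv ℝ (fun y => F (x, y)) e v := by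
    filter_upwards [hc.eventually (eventually_differentiableAt_prod hF),
      hc'.eventually (eventually_differentiableAt_prod hF),
      hc.eventually (eventually_differentiableAt_prod hC), hC1,
      hc.eventually hFC.eventually_nhds] with x h1 h2 h3 h4 h5
    have hy : Tendsto (fun y : E => (x, y)) (𝓝 e) (𝓝 (x, e)) :=
      (Continuous.prodMk_right x).continuousAt
    have hCd := hasFDerivAt_partial_right h3
    have hF' : HasFDerivAt (fun z => F (z, x))
        ((fderiv ℝ F (e, x)).comp (ContinuousLinearMap.inl ℝ E E)) (C (x, e)) := by
      rw [h4]; exact hasFDerivAt_partial_left h2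
    have h6 := hF'.comp e hCd
    have h7 := h6.unique ((hasFDerivAt_partial_right h1).congr_of_eventuallyEq
      (hy.eventually h5))
    rw [hCd.fderiv, (hasFDerivAt_partial_right h1).fderiv]
    simpa using DFunLike.congr_fun h7 v
  have hFd : HasFDerivAt (fderiv ℝ F) (fderiv ℝ (fderiv ℝ F) (e, e)) (e, e) :=
    ((hF.fderiv_right (m := 1) (by norm_num)).differentiableAt (by simp)).hasFDerivAt
  have hCx := hasFDerivAt_partial_right_along hC v
  have hFx := hasFDerivAt_partial_right_along hF v
  have hL := (hFd.comp (f := fun x : E => (e, x)) e (hasFDerivAt_prodMk_right e e)).clm_apply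
    (hCx.prodMk (hasFDerivAt_const (0 : E) e))
  have hE := hL.unique (hFx.congr_of_eventuallyEq key)
  have hCe : fderiv ℝ (fun y => C (e, y)) e v = v := by
    have := key.self_of_nhds
    rwa [hl, (hasFDerivAt_partial_right dF).fderiv, ContinuousLinearMap.comp_apply,
      ContinuousLinearMap.inr_apply, hr] at this
  have hs : IsSymmSndFDerivAt ℝ F (e, e) := hF.isSymmSndFDerivAt (by simp)
  have h8 := DFunLike.congr_fun hE w
  simp only [Function.comp_apply, _root_.add_apply, ContinuousLinearMap.comp_apply,
    ContinuousLinearMap.flip_apply, ContinuousLinearMap.prod_apply,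
    _root_.zero_apply, ContinuousLinearMap.inl_apply, ContinuousLinearMap.inr_apply,
    hl, hCe] at h8
  rw [hCx.fderiv, hFx.fderiv, (hasFDerivAt_partial_right_along hF w).fderiv]
  simp only [ContinuousLinearMap.comp_apply, ContinuousLinearMap.flip_apply,
    ContinuousLinearMap.inl_apply]
  rw [hs (v, 0) (0, w), ← h8]
  abel

end LocalGroup

/-! ### The differential of the adjoint representation -/

section AdjointDerivative

variable {N : ℕ} {G : Type*} [TopologicalSpace G] [ChartedSpace (EuclideanSpace ℝ (Fin N)) G]
  [Group G]

local notation "𝔼" => EuclideanSpace ℝ (Fin N)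
local notation "φ" => extChartAt (𝓡 N) (1 : G)

variable (N G) in
/-- The multiplication of `G` read in the chart at `1`. -/
def chartMul (p : 𝔼 × 𝔼) : 𝔼 := φ ((φ).symm p.1 * (φ).symm p.2)

variable (N G) in
/-- The conjugation `(x, y) ↦ x y x⁻¹` of `G` read in the chart at `1`. -/
def chartConj (p : 𝔼 × 𝔼) : 𝔼 := φ ((φ).symm p.1 * (φ).symm p.2 * ((φ).symm p.1)⁻¹)

/-- `Ad g`, as an endomorphism of the model space. -/
def AdE (g : G) : 𝔼 →L[ℝ] 𝔼 := Ad (N := N) g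

/-- `ad X`, as an endomorphism of the model space. -/
def adE [LieGroup (𝓡 N) ∞ G] (X : LieAlg N G) : 𝔼 →L[ℝ] 𝔼 :=
  LinearMap.toContinuousLinearMap
    ((coord (N := N) (G := G)).toLinearEquiv.conj (LieAlgebra.ad ℝ (LieAlg N G) X))

theorem coord_Ad (g : G) (Y : LieAlg N G) : coord (Ad g Y) = AdE g (coord Y) := rfl

theorem symm_extChartAt_one : (φ).symm (φ 1) = 1 := (φ).left_inv (mem_extChartAt_source 1)

variable [LieGroup (𝓡 N) ∞ G]

theorem adE_coord (X Y : LieAlg N G) : adE X (coord Y) = coord ⁅X, Y⁆ := by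
  simp [adE, LinearEquiv.conj_apply]

theorem contMDiffAt_symm_one : ContMDiffAt 𝓘(ℝ, 𝔼) (𝓡 N) ∞ (φ).symm (φ 1) := by
  have : IsManifold (𝓡 N) ∞ G := (‹LieGroup (𝓡 N) ∞ G›).toContMDiffMul.toIsManifold
  exact (contMDiffOn_extChartAt_symm (1 : G)).contMDiffAt (extChartAt_target_mem_nhds 1)

theorem contMDiffAt_symm_fst : ContMDiffAt 𝓘(ℝ, 𝔼 × 𝔼) (𝓡 N) ∞
    (fun p : 𝔼 × 𝔼 => (φ).symm p.1) (φ 1, φ 1) :=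
  ContMDiffAt.comp (g := (φ).symm) (f := Prod.fst) (φ 1, φ 1) contMDiffAt_symm_one
    contDiffAt_fst.contMDiffAt

theorem contMDiffAt_symm_snd : ContMDiffAt 𝓘(ℝ, 𝔼 × 𝔼) (𝓡 N) ∞
    (fun p : 𝔼 × 𝔼 => (φ).symm p.2) (φ 1, φ 1) :=
  ContMDiffAt.comp (g := (φ).symm) (f := Prod.snd) (φ 1, φ 1) contMDiffAt_symm_one
    contDiffAt_snd.contMDiffAt

theorem contDiffAt_extChartAt_comp {f : 𝔼 × 𝔼 → G}
    (hf : ContMDiffAt 𝓘(ℝ, 𝔼 × 𝔼) (𝓡 N) ∞ f (φ 1, φ 1)) (h1 : f (φ 1, φ 1) = 1) :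
    ContDiffAt ℝ 2 (fun p => φ (f p)) (φ 1, φ 1) := by
  have : IsManifold (𝓡 N) ∞ G := (‹LieGroup (𝓡 N) ∞ G›).toContMDiffMul.toIsManifold
  refine ContDiffAt.of_le (n := ∞) ?_ (by norm_cast)
  rw [← contMDiffAt_iff_contDiffAt]
  refine ContMDiffAt.comp (g := φ) (f := f) _ ?_ hf
  rw [h1]
  exact contMDiffAt_extChartAt

theorem contDiffAt_chartMul : ContDiffAt ℝ 2 (chartMul N G) (φ 1, φ 1) :=
  contDiffAt_extChartAt_comp (contMDiffAt_symm_fst.mul contMDiffAt_symm_snd)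
    (by simp)

theorem contDiffAt_chartConj : ContDiffAt ℝ 2 (chartConj N G) (φ 1, φ 1) :=
  contDiffAt_extChartAt_comp
    ((contMDiffAt_symm_fst.mul contMDiffAt_symm_snd).mul contMDiffAt_symm_fst.inv)
    (by simp)

theorem AdE_eq_fderiv (g : G) : AdE g = fderiv ℝ (fun y : 𝔼 => φ (g * (φ).symm y * g⁻¹)) (φ 1) := by
  have hd : MDifferentiableAt (𝓡 N) (𝓡 N) (fun x : G => g * x * g⁻¹) 1 :=
    (contMDiff_conj (N := N) g).mdifferentiableAt (by simp)
  refine (show AdE g = _ from hd.mfderiv).trans ?_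
  simp only [writtenInExtChartAt, mul_one, mul_inv_cancel]
  rw [show range (𝓡 N) = univ by simp, fderivWithin_univ]
  rfl

theorem AdE_symm (x : 𝔼) :
    AdE ((φ).symm x) = fderiv ℝ (fun y : 𝔼 => chartConj N G (x, y)) (φ 1) :=
  AdE_eq_fderiv _

/-- In the chart at `1`, a left-invariant vector field is the partial derivative of the
multiplication in its second variable. -/
theorem mpullback_mulInvariantVectorField_chart (X : LieAlg N G) :
    ∀ᶠ x in 𝓝 (φ 1), VectorField.mpullbackWithin 𝓘(ℝ, 𝔼) (𝓡 N) (φ).symm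
        (mulInvariantVectorField X) (range (𝓡 N)) x =
      fderiv ℝ (fun y : 𝔼 => chartMul N G (x, y)) (φ 1) (coord X) := by
  have : IsManifold (𝓡 N) ∞ G := (‹LieGroup (𝓡 N) ∞ G›).toContMDiffMul.toIsManifold
  have : IsManifold (𝓡 N) 1 G := IsManifold.of_le (n := ∞) (by simp)
  filter_upwards [extChartAt_target_mem_nhds (I := 𝓡 N) (1 : G)] with x hx
  have hinv : (mfderivWithin 𝓘(ℝ, 𝔼) (𝓡 N) (φ).symm (range (𝓡 N)) x).inverse =
      mfderiv (𝓡 N) 𝓘(ℝ, 𝔼) φ ((φ).symm x) :=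
    ContinuousLinearMap.inverse_eq
      (mfderivWithin_extChartAt_symm_comp_mfderiv_extChartAt hx)
      (mfderiv_extChartAt_comp_mfderivWithin_extChartAt_symm hx)
  rw [VectorField.mpullbackWithin_apply, hinv]
  have hd : MDifferentiableAt (𝓡 N) (𝓡 N) (fun y : G => (φ).symm x * y) 1 :=
    (contMDiff_mul_left (I := 𝓡 N) (n := ∞)).mdifferentiableAt (by simp)
  have hφ : MDifferentiableAt (𝓡 N) 𝓘(ℝ, 𝔼) φ ((φ).symm x * 1) := by
    rw [mul_one]
    exact mdifferentiableAt_extChartAt (by simpa using (φ).map_target hx)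
  have hc := mfderiv_comp (1 : G) hφ hd
  have hm := hφ.comp (1 : G) hd
  unfold mulInvariantVectorField
  have h1 : fderiv ℝ (fun y : 𝔼 => chartMul N G (x, y)) (φ 1) =
      mfderiv (𝓡 N) 𝓘(ℝ, 𝔼) (φ ∘ fun y : G => (φ).symm x * y) 1 := by
    refine .trans ?_ (hm.mfderiv).symm
    rw [show range (𝓡 N) = univ by simp, fderivWithin_univ]
    rfl
  have h2 := h1.trans hc
  have h3 : ∀ g g' : G, g = g' → (mfderiv (𝓡 N) 𝓘(ℝ, 𝔼) φ g : 𝔼 →L[ℝ] 𝔼) =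
      mfderiv (𝓡 N) 𝓘(ℝ, 𝔼) φ g' := by
    rintro g _ rfl
    rfl
  rw [h2]
  exact (congrArg (fun A : 𝔼 →L[ℝ] 𝔼 => A (mfderiv (𝓡 N) (𝓡 N) (fun y : G => (φ).symm x * y) 1 X))
    (h3 _ _ (mul_one _))).symm

/-- The bracket of `𝔤` is the antisymmetrization of the mixed second derivative of the
multiplication in the chart at `1`. -/
theorem coord_bracket (X Y : LieAlg N G) :
    coord ⁅X, Y⁆ =
      fderiv ℝ (fun x => fderiv ℝ (fun y : 𝔼 => chartMul N G (x, y)) (φ 1) (coord Y)) (φ 1)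
          (coord X) -
        fderiv ℝ (fun x => fderiv ℝ (fun y : 𝔼 => chartMul N G (x, y)) (φ 1) (coord X)) (φ 1)
          (coord Y) := by
  have hX := mpullback_mulInvariantVectorField_chart X
  have hY := mpullback_mulInvariantVectorField_chart Y
  have hone : ∀ u : 𝔼, fderiv ℝ (fun y : 𝔼 => chartMul N G (φ 1, y)) (φ 1) u = u := by
    intro u
    have : (fun y : 𝔼 => chartMul N G (φ 1, y)) =ᶠ[𝓝 (φ 1)] id := by
      filter_upwards [extChartAt_target_mem_nhds (I := 𝓡 N) (1 : G)] with x hx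
      simp only [chartMul, symm_extChartAt_one, one_mul, (φ).right_inv hx, id]
    rw [this.fderiv_eq, fderiv_id]
    rfl
  have : IsManifold (𝓡 N) ∞ G := (‹LieGroup (𝓡 N) ∞ G›).toContMDiffMul.toIsManifold
  have : IsManifold (𝓡 N) 1 G := IsManifold.of_le (n := ∞) (by simp)
  have hid : (mfderiv (𝓡 N) 𝓘(ℝ, 𝔼) φ (1 : G) : 𝔼 →L[ℝ] 𝔼).inverse =
      ContinuousLinearMap.id ℝ 𝔼 :=
    (congrArg (fun A : 𝔼 →L[ℝ] 𝔼 => A.inverse)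
      (mfderiv_extChartAt_self (I := 𝓡 N) (x := (1 : G)))).trans ContinuousLinearMap.inverse_id
  have hb := (VectorField.mlieBracketWithin_apply (I := 𝓡 N) (s := univ) (x₀ := (1 : G))
    (V := mulInvariantVectorField X) (W := mulInvariantVectorField Y))
  have hb' := hb.trans (congrArg (fun A : 𝔼 →L[ℝ] 𝔼 => A _) hid)
  refine hb'.trans ?_
  rw [show range (𝓡 N) = univ by simp] at hX hY
  simp only [ContinuousLinearMap.id_apply, preimage_univ, univ_inter,
    show range (𝓡 N) = univ by simp]
  refine (congrFun (VectorField.lieBracketWithin_univ (𝕜 := ℝ) (E := 𝔼)) _).trans ?_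
  refine (Filter.EventuallyEq.lieBracket_vectorField_eq (𝕜 := ℝ) (E := 𝔼) hX hY).trans ?_
  rw [VectorField.lieBracket_eq]
  simp only [hone]

/-- The differential at `1` of `g ↦ Ad g Y` is `X ↦ [X, Y]`. -/
theorem hasFDerivAt_AdE_symm (Y : LieAlg N G) :
    ∃ D : 𝔼 →L[ℝ] 𝔼, HasFDerivAt (fun x : 𝔼 => AdE ((φ).symm x) (coord Y)) D (φ 1) ∧
      ∀ X : LieAlg N G, D (coord X) = coord ⁅X, Y⁆ := by
  have hd := (hasFDerivAt_partial_right_along (contDiffAt_chartConj (N := N) (G := G))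
    (coord Y)).differentiableAt
  refine ⟨fderiv ℝ (fun x => fderiv ℝ (fun y : 𝔼 => chartConj N G (x, y)) (φ 1) (coord Y)) (φ 1),
    ?_, fun X => ?_⟩
  · simp only [AdE_symm]
    exact hd.hasFDerivAt
  have htar := extChartAt_target_mem_nhds (I := 𝓡 N) (1 : G)
  rw [coord_bracket]
  refine hasFDerivAt_conj_of_mul contDiffAt_chartMul contDiffAt_chartConj ?_ ?_ ?_ ?_ _ _
  · filter_upwards [htar] with x hx
    simp only [chartMul, symm_extChartAt_one, mul_one, (φ).right_inv hx]
  · filter_upwards [htar] with x hx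
    simp only [chartMul, symm_extChartAt_one, one_mul, (φ).right_inv hx]
  · exact .of_forall fun x => by simp [chartConj]
  · have hcont : ContinuousAt (fun p : 𝔼 × 𝔼 => (φ).symm p.1 * (φ).symm p.2 * ((φ).symm p.1)⁻¹)
        (φ 1, φ 1) :=
      ((contMDiffAt_symm_fst.mul contMDiffAt_symm_snd).mul contMDiffAt_symm_fst.inv).continuousAt
    have hsrc : (φ).source ∈ 𝓝 ((φ).symm (φ 1) * (φ).symm (φ 1) * ((φ).symm (φ 1))⁻¹) := by
      simp only [symm_extChartAt_one, mul_one, inv_one]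
      exact extChartAt_source_mem_nhds 1
    filter_upwards [hcont.preimage_mem_nhds hsrc] with p hp
    simp only [chartMul, chartConj]
    rw [(φ).left_inv hp]
    simp

end AdjointDerivative

/-! ### One-parameter subgroups -/

section OneParameter

variable {N : ℕ} {G : Type*} [TopologicalSpace G] [ChartedSpace (EuclideanSpace ℝ (Fin N)) G]
  [Group G]

local notation "𝔼" => EuclideanSpace ℝ (Fin N)
local notation "φ" => extChartAt (𝓡 N) (1 : G)

theorem HasVelocity.continuousAt {γ : ℝ → G} {X : LieAlg N G} (h : HasVelocity γ X) :
    ContinuousAt γ 0 := h.2.1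

theorem HasVelocity.hasDerivAt_chart {γ : ℝ → G} {X : LieAlg N G} (h : HasVelocity γ X) :
    HasDerivAt (fun t => φ (γ t)) (coord X) 0 := by
  have h2 := h.2.2
  simp only [writtenInExtChartAt, h.1] at h2
  have h3 : HasFDerivWithinAt (fun t => φ (γ t))
    (ContinuousLinearMap.toSpanSingleton ℝ (X : 𝔼)) (range 𝓘(ℝ, ℝ)) (0 : ℝ) := h2
  rw [modelWithCornersSelf_coe, range_id, hasFDerivWithinAt_univ] at h3
  have h4 := HasFDerivAt.hasDerivAt h3
  have e : (ContinuousLinearMap.toSpanSingleton ℝ (X : 𝔼)) 1 = coord X := one_smul ℝ _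
  exact h4.congr_deriv e

theorem AdE_one : AdE (N := N) (1 : G) = ContinuousLinearMap.id ℝ 𝔼 :=
  ContinuousLinearMap.ext fun v => Ad_one (N := N) (G := G) (coord.symm v)

variable [LieGroup (𝓡 N) ∞ G]

theorem AdE_mul (g h : G) : AdE (N := N) (g * h) = (AdE g).comp (AdE h) :=
  ContinuousLinearMap.ext fun v => Ad_mul g h (coord.symm v)

theorem HasVelocity.hasDerivAt_AdE {γ : ℝ → G} {X : LieAlg N G} (h : HasVelocity γ X) (v : 𝔼) :
    HasDerivAt (fun t => AdE (γ t) v) (adE X v) 0 := by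
  obtain ⟨Y, rfl⟩ := (coord (N := N) (G := G)).surjective v
  obtain ⟨D, hD, hD'⟩ := hasFDerivAt_AdE_symm Y
  rw [← h.1] at hD
  have hc := HasFDerivAt.comp_hasDerivAt (f := fun t => extChartAt (𝓡 N) (γ 0) (γ t)) (0 : ℝ) hD
    (by rw [h.1]; exact h.hasDerivAt_chart)
  rw [h.1] at hc
  rw [adE_coord, ← hD']
  refine hc.congr_of_eventuallyEq ?_
  filter_upwards [h.continuousAt.preimage_mem_nhds
    (by rw [h.1]; exact extChartAt_source_mem_nhds (I := 𝓡 N) 1)] with t ht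
  simp only [Function.comp_apply]
  rw [(φ).left_inv ht]

/-- Differentiability of `Ad` at `1` gives continuity there, and multiplicativity spreads it. -/
theorem continuous_AdE_apply (v : 𝔼) : Continuous fun g : G => AdE g v := by
  have : IsTopologicalGroup G := topologicalGroup_of_lieGroup (𝓡 N) ∞
  obtain ⟨Y, rfl⟩ := (coord (N := N) (G := G)).surjective v
  obtain ⟨D, hD, -⟩ := hasFDerivAt_AdE_symm Y
  have h1 : ContinuousAt (fun g : G => AdE g (coord Y)) 1 := by
    have hc : ContinuousAt (fun g : G => AdE ((φ).symm (φ g)) (coord Y)) 1 :=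
      ContinuousAt.comp (f := φ) (x := (1 : G)) hD.continuousAt (continuousAt_extChartAt 1)
    refine hc.congr ?_
    filter_upwards [extChartAt_source_mem_nhds (I := 𝓡 N) (1 : G)] with g hg
    rw [(φ).left_inv hg]
  rw [continuous_iff_continuousAt]
  intro g
  have hg : ContinuousAt (fun x : G => g⁻¹ * x) g :=
    (continuous_const.mul continuous_id).continuousAt
  have h2 : ContinuousAt (fun x : G => AdE g (AdE (g⁻¹ * x) (coord Y))) g := by
    refine ContinuousAt.comp (g := fun v => AdE (N := N) g v)
      (f := fun x : G => AdE (g⁻¹ * x) (coord Y)) (AdE (N := N) g).continuous.continuousAt ?_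
    refine ContinuousAt.comp (g := fun x : G => AdE x (coord Y)) (f := fun x : G => g⁻¹ * x) ?_ hg
    rw [inv_mul_cancel]
    exact h1
  convert h2 using 2 with x
  rw [← ContinuousLinearMap.comp_apply, ← AdE_mul, mul_inv_cancel_left]

/-- Left translates of integral curves of a left-invariant vector field are integral curves. -/
theorem hasMFDerivAt_mul_left_invariant {γ : ℝ → G} {X : LieAlg N G} {t : ℝ}
    (h : HasMFDerivAt 𝓘(ℝ, ℝ) (𝓡 N) γ t
      ((1 : ℝ →L[ℝ] ℝ).smulRight (mulInvariantVectorField X (γ t)))) (g : G) :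
    HasMFDerivAt 𝓘(ℝ, ℝ) (𝓡 N) (fun s => g * γ s) t
      ((1 : ℝ →L[ℝ] ℝ).smulRight (mulInvariantVectorField X (g * γ t))) := by
  have hg : ∀ a b : G, HasMFDerivAt (𝓡 N) (𝓡 N) (fun x : G => a * x) b
      (mfderiv (𝓡 N) (𝓡 N) (fun x : G => a * x) b) := fun a b =>
    ((contMDiff_mul_left (I := 𝓡 N) (n := ∞)).mdifferentiableAt (by simp)).hasMFDerivAt
  have h1 := (hg g (γ t)).comp t h
  refine h1.congr_mfderiv ?_
  have h2 : HasMFDerivAt (𝓡 N) (𝓡 N) (fun x : G => g * (γ t * x)) 1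
      ((mfderiv (𝓡 N) (𝓡 N) (fun x : G => g * x) (γ t) : 𝔼 →L[ℝ] 𝔼).comp
        (mfderiv (𝓡 N) (𝓡 N) (fun x : G => γ t * x) 1 : 𝔼 →L[ℝ] 𝔼)) := by
    refine HasMFDerivAt.comp (g := fun x : G => g * x) (f := fun x : G => γ t * x) (1 : G) ?_
      (hg (γ t) 1)
    rw [mul_one]
    exact hg g (γ t)
  have h3 : (fun x : G => g * (γ t * x)) = fun x : G => (g * γ t) * x := by
    ext x; rw [mul_assoc]
  rw [h3] at h2
  have h4 : mulInvariantVectorField X (g * γ t) =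
      (mfderiv (𝓡 N) (𝓡 N) (fun x : G => g * x) (γ t) : 𝔼 →L[ℝ] 𝔼)
        (mulInvariantVectorField X (γ t)) :=
    DFunLike.congr_fun h2.mfderiv X
  rw [h4]
  refine ContinuousLinearMap.ext fun (s : ℝ) => ?_
  exact map_smul (mfderiv (𝓡 N) (𝓡 N) (fun x : G => g * x) (γ t) : 𝔼 →L[ℝ] 𝔼) s
    (mulInvariantVectorField X (γ t) : 𝔼)

/-- Left-invariant vector fields are complete. -/
theorem exists_isMIntegralCurve_mulInvariantVectorField [T2Space G] (X : LieAlg N G) :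
    ∃ γ : ℝ → G, γ 0 = 1 ∧ IsMIntegralCurve (I := 𝓡 N) γ (mulInvariantVectorField X) := by
  have : IsManifold (𝓡 N) ∞ G := (‹LieGroup (𝓡 N) ∞ G›).toContMDiffMul.toIsManifold
  have : IsManifold (𝓡 N) 1 G := IsManifold.of_le (n := ∞) (by simp)
  have hv : ContMDiff (𝓡 N) (𝓡 N).tangent 1
      (fun g : G => (⟨g, mulInvariantVectorField X g⟩ : TangentBundle (𝓡 N) G)) :=
    (contMDiff_mulInvariantVectorField X).of_le (by
      rw [minSmoothness_of_isRCLikeNormedField]; norm_num)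
  obtain ⟨γ, h0, hγ⟩ := exists_isMIntegralCurveAt_of_contMDiffAt_boundaryless (t₀ := (0 : ℝ))
    (x₀ := (1 : G)) hv.contMDiffAt
  obtain ⟨ε, hε, hγ⟩ := isMIntegralCurveAt_iff'.1 hγ
  refine exists_isMIntegralCurve_of_isMIntegralCurveOn hv hε (fun g => ?_) 1
  refine ⟨fun t => g * γ t, by simp [h0], fun t ht => ?_⟩
  have ht' : Metric.ball (0 : ℝ) ε ∈ 𝓝 t :=
    Metric.isOpen_ball.mem_nhds (by rw [Real.ball_eq_Ioo]; simpa using ht)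
  exact (hasMFDerivAt_mul_left_invariant
    ((hγ t (mem_of_mem_nhds ht')).hasMFDerivAt ht') g).hasMFDerivWithinAt

/-- A solution of the linear equation `f' = A f` near `0` is `t ↦ exp (t A) (f 0)`: the derivative
of `t ↦ exp (-t A) (f t)` vanishes. -/
theorem eq_exp_of_hasDerivAt {E : Type*} [NormedAddCommGroup E] [NormedSpace ℝ E] [CompleteSpace E]
    {A : E →L[ℝ] E} {f : ℝ → E} {s : Set ℝ} (hs : IsOpen s) (hs' : IsPreconnected s) (h0 : 0 ∈ s)
    (hf : ∀ t ∈ s, HasDerivAt f (A (f t)) t) {t : ℝ} (ht : t ∈ s) :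
    f t = NormedSpace.exp (t • A) (f 0) := by
  let _ : NormedAlgebra ℚ (E →L[ℝ] E) := NormedAlgebra.restrictScalars ℚ ℝ _
  have hinv : ∀ r : ℝ, NormedSpace.exp (r • A) * NormedSpace.exp (r • (-A)) = 1 := by
    intro r
    rw [smul_neg, ← NormedSpace.exp_add_of_commute (Commute.neg_right (Commute.refl _)),
      add_neg_cancel, NormedSpace.exp_zero]
  have hd : ∀ r ∈ s, HasDerivAt (fun r => NormedSpace.exp (r • (-A)) (f r)) 0 r := by
    intro r hr
    have h1 := (hasDerivAt_exp_smul_const (𝕂 := ℝ) (-A) r).clm_apply (hf r hr)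
    convert h1 using 1
    simp
  have hc : NormedSpace.exp (t • (-A)) (f t) = NormedSpace.exp ((0 : ℝ) • (-A)) (f 0) :=
    hs.is_const_of_deriv_eq_zero hs' (fun r hr => (hd r hr).differentiableAt.differentiableWithinAt)
      (fun r hr => (hd r hr).deriv) ht h0
  rw [zero_smul, NormedSpace.exp_zero] at hc
  have h2 := congrArg (fun v => NormedSpace.exp (t • A) v) hc
  rwa [← ContinuousLinearMap.comp_apply, ← ContinuousLinearMap.mul_def, hinv] at h2

/-- The one-parameter subgroup of `G` generated by `X`: the integral curve through `1` of the
left-invariant vector field of `X`. It acts on `𝔤` by `exp (t ad X)`. -/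
theorem exists_oneParameter [T2Space G] (X : LieAlg N G) :
    ∃ γ : ℝ → G, Continuous γ ∧ HasVelocity γ X ∧ ∀ t, AdE (γ t) = NormedSpace.exp (t • adE X) := by
  have : IsManifold (𝓡 N) ∞ G := (‹LieGroup (𝓡 N) ∞ G›).toContMDiffMul.toIsManifold
  have : IsManifold (𝓡 N) 1 G := IsManifold.of_le (n := ∞) (by simp)
  have hv : ContMDiff (𝓡 N) (𝓡 N).tangent 1
      (fun g : G => (⟨g, mulInvariantVectorField X g⟩ : TangentBundle (𝓡 N) G)) :=
    (contMDiff_mulInvariantVectorField X).of_le (by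
      rw [minSmoothness_of_isRCLikeNormedField]; norm_num)
  obtain ⟨γ, h0, hγ⟩ := exists_isMIntegralCurve_mulInvariantVectorField X
  have hadd : ∀ s t, γ (t + s) = γ s * γ t := fun s t => by
    refine congrFun (isMIntegralCurve_Ioo_eq_of_contMDiff_boundaryless (t₀ := (0 : ℝ)) hv
      (hγ.comp_add s) (γ' := fun t => γ s * γ t)
      (fun t => hasMFDerivAt_mul_left_invariant (hγ t) _) ?_) t
    simp [h0]
  have hvel : HasVelocity γ X := by
    refine ⟨h0, (hγ 0).congr_mfderiv ?_⟩
    have h1 : mulInvariantVectorField X (γ 0) = (X : 𝔼) := by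
      rw [h0]
      have h2 : mfderiv (𝓡 N) (𝓡 N) (fun z : G => 1 * z) 1 = ContinuousLinearMap.id ℝ _ :=
        ((hasMFDerivAt_id (I := 𝓡 N) (1 : G)).congr_of_eventuallyEq
          (.of_forall fun z => one_mul z)).mfderiv
      exact DFunLike.congr_fun h2 X
    rw [h1]
    rfl
  refine ⟨γ, hγ.continuous, hvel, fun t => ContinuousLinearMap.ext fun v => ?_⟩
  have h1 := eq_exp_of_hasDerivAt (A := adE X) (f := fun t => AdE (γ t) v) isOpen_univ
    isPreconnected_univ (mem_univ 0) (fun t _ => ?_) (mem_univ t)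
  · simpa [h0, AdE_one] using h1
  · have h2 := hvel.hasDerivAt_AdE (AdE (γ t) v)
    have h3 : HasDerivAt (fun r => AdE (γ (r - t)) (AdE (γ t) v)) (adE X (AdE (γ t) v)) t := by
      refine HasDerivAt.comp_sub_const (f := fun r => AdE (γ r) (AdE (γ t) v)) t t ?_
      rwa [sub_self]
    refine h3.congr_of_eventuallyEq (.of_forall fun r => ?_)
    dsimp only
    rw [← ContinuousLinearMap.comp_apply, ← AdE_mul, ← hadd]
    simp

end OneParameter

/-! ### Skew endomorphisms of a Euclidean space -/

section SkewEndomorphism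

variable {E : Type*} [AddCommGroup E] [Module ℝ E] {b : LinearMap.BilinForm ℝ E}

/-- The polynomial in `(ad q)²` occurring in the complex structure of the flag manifold: it takes
the value `(√(-μ))⁻¹` at each eigenvalue `μ`. -/
def sqrtInvPoly (T : Module.End ℝ E) : Polynomial ℝ :=
  Lagrange.interpolate (minpoly ℝ T).roots.toFinset id fun μ => (Real.sqrt (-μ))⁻¹

variable (b) in
/-- The inner product space structure defined by a positive definite symmetric form. -/
abbrev coreOfForm (hs : ∀ x y, b x y = b y x) (hp : ∀ x, x ≠ 0 → 0 < b x x) :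
    InnerProductSpace.Core ℝ E where
  inner x y := b x y
  conj_inner_symm x y := hs y x
  re_inner_nonneg x := by
    by_cases h : x = 0
    · simp [h]
    · exact (hp x h).le
  add_left x y z := by simp
  smul_left x y r := by simp
  definite x h := by
    by_contra hx
    exact (hp x hx).ne' h

theorem aeval_symm {T : Module.End ℝ E} (hT : ∀ x y, b (T x) y = b x (T y)) (p : Polynomial ℝ)
    (x y : E) : b (Polynomial.aeval T p x) y = b x (Polynomial.aeval T p y) := by
  induction p using Polynomial.induction_on generalizing x y with
  | C a => simp [Module.algebraMap_end_apply]
  | add p q hp hq => simp [hp, hq]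
  | monomial n a h =>
    have hc : Commute T (Polynomial.aeval T (Polynomial.C a * Polynomial.X ^ n)) := by
      have h1 := (Polynomial.commute_X (Polynomial.C a * Polynomial.X ^ n)).map
        (Polynomial.aeval T (R := ℝ))
      rwa [Polynomial.aeval_X] at h1
    rw [pow_succ, ← mul_assoc, map_mul, Polynomial.aeval_X, ← hc.eq, Module.End.mul_apply, hT, h,
      hc.eq, Module.End.mul_apply]

theorem nondegenerate_of_pos (hs : ∀ x y, b x y = b y x) (hp : ∀ x, x ≠ 0 → 0 < b x x) :
    b.Nondegenerate := by
  have hr : b.IsRefl := fun x y h => by rw [hs, h]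
  refine (LinearMap.IsRefl.nondegenerate_iff_separatingLeft hr).2 fun x hx => ?_
  by_contra h
  exact (hp x h).ne' (hx x)

variable [FiniteDimensional ℝ E]

theorem exists_orthonormal_eigenbasis (hs : ∀ x y, b x y = b y x) (hp : ∀ x, x ≠ 0 → 0 < b x x)
    {T : Module.End ℝ E} (hT : ∀ x y, b (T x) y = b x (T y)) :
    ∃ (u : Fin (Module.finrank ℝ E) → E) (μ : Fin (Module.finrank ℝ E) → ℝ),
      (∀ i, Module.End.HasEigenvector T (μ i) (u i)) ∧
      ∀ x y, ∑ i, b x (u i) * b (u i) y = b x y := by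
  let c := coreOfForm b hs hp
  let _ : NormedAddCommGroup E := c.toNormedAddCommGroup
  let _ : InnerProductSpace ℝ E := InnerProductSpace.ofCore c.toCore
  have hT' : T.IsSymmetric := hT
  refine ⟨hT'.eigenvectorBasis rfl, hT'.eigenvalues rfl,
    fun i => hT'.hasEigenvector_eigenvectorBasis rfl i, fun x y => ?_⟩
  exact (hT'.eigenvectorBasis rfl).sum_inner_mul_inner x y

/-- `tr A² = -∑ ‖A eᵢ‖²` for a skew endomorphism `A` and an orthonormal basis `eᵢ`. -/
theorem trace_sq_neg_of_skew (hs : ∀ x y, b x y = b y x) (hp : ∀ x, x ≠ 0 → 0 < b x x)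
    {A : Module.End ℝ E} (hA : ∀ x y, b (A x) y = -b x (A y)) (hA0 : A ≠ 0) :
    LinearMap.trace ℝ E (A * A) < 0 := by
  let c := coreOfForm b hs hp
  let _ : NormedAddCommGroup E := c.toNormedAddCommGroup
  let _ : InnerProductSpace ℝ E := InnerProductSpace.ofCore c.toCore
  let e := stdOrthonormalBasis ℝ E
  have h1 : LinearMap.trace ℝ E (A * A) = ∑ i, b (e i) (A (A (e i))) :=
    LinearMap.trace_eq_sum_inner (A * A) e
  have h2 : ∀ i, b (e i) (A (A (e i))) = -b (A (e i)) (A (e i)) := fun i => by rw [hA]; simp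
  have hnn : ∀ x, 0 ≤ b x x := fun x => c.re_inner_nonneg x
  simp only [h2, Finset.sum_neg_distrib] at h1
  rw [h1, neg_lt_zero]
  obtain ⟨i, hi⟩ : ∃ i, A (e i) ≠ 0 := by
    by_contra! h
    exact hA0 (e.toBasis.ext fun i => by simpa using h i)
  exact Finset.sum_pos' (fun i _ => hnn _) ⟨i, Finset.mem_univ _, hp _ hi⟩

/-- `(-A²)^{-1/2}` is positive definite on the range of a skew endomorphism `A`. -/
theorem sqrtInvPoly_pos (hs : ∀ x y, b x y = b y x) (hp : ∀ x, x ≠ 0 → 0 < b x x)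
    {A : Module.End ℝ E} (hA : ∀ x y, b (A x) y = -b x (A y)) {v : E}
    (hv : v ∈ LinearMap.range A) (hv0 : v ≠ 0) :
    0 < b v (Polynomial.aeval (A * A) (sqrtInvPoly (A * A)) v) := by
  have hT : ∀ x y, b ((A * A) x) y = b x ((A * A) y) := fun x y => by
    simp [hA]
  obtain ⟨u, μ, hu, hsum⟩ := exists_orthonormal_eigenbasis hs hp hT
  have hP : ∀ i, Polynomial.aeval (A * A) (sqrtInvPoly (A * A)) (u i) =
      (Real.sqrt (-μ i))⁻¹ • u i := fun i => by
    have hr : μ i ∈ (minpoly ℝ (A * A)).roots.toFinset := by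
      rw [Multiset.mem_toFinset, Polynomial.mem_roots
        (minpoly.ne_zero (Algebra.IsIntegral.isIntegral (R := ℝ) (A * A)))]
      exact Module.End.isRoot_of_hasEigenvalue (Module.End.hasEigenvalue_of_hasEigenvector (hu i))
    rw [Module.End.aeval_apply_of_hasEigenvector (hu i)]
    congr 1
    exact Lagrange.eval_interpolate_at_node (r := fun μ => (Real.sqrt (-μ))⁻¹) (v := id)
      (Function.injective_id.injOn) hr
  have hneg : ∀ i, A (u i) ≠ 0 → μ i < 0 := fun i hi => by
    have h1 : b (A (u i)) (A (u i)) = -(μ i * b (u i) (u i)) := by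
      have h2 := (hu i).apply_eq_smul
      rw [Module.End.mul_apply] at h2
      rw [hA, h2, map_smul, smul_eq_mul]
    have h3 := hp _ hi
    have h4 := hp _ (hu i).2
    rw [h1] at h3
    by_contra! h5
    nlinarith [mul_nonneg h5 h4.le]
  -- the eigenvectors in `ker A` (where `(√0)⁻¹ = 0`) are orthogonal to `v ∈ range A`
  have hterm : ∀ i, b v (u i) ≠ 0 → 0 < (Real.sqrt (-μ i))⁻¹ := fun i hi => by
    have : A (u i) ≠ 0 := fun h0 => by
      obtain ⟨x, rfl⟩ := hv
      rw [hA, h0, map_zero, neg_zero] at hi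
      exact hi rfl
    exact inv_pos.2 (Real.sqrt_pos.2 (neg_pos.2 (hneg i this)))
  have hexp : b v (Polynomial.aeval (A * A) (sqrtInvPoly (A * A)) v) =
      ∑ i, (Real.sqrt (-μ i))⁻¹ * (b v (u i) * b v (u i)) := by
    rw [← hsum]
    refine Finset.sum_congr rfl fun i _ => ?_
    rw [← aeval_symm hT, hP, map_smul, LinearMap.smul_apply, smul_eq_mul, hs (u i) v]
    ring
  rw [hexp]
  obtain ⟨i, hi⟩ : ∃ i, b v (u i) ≠ 0 := by
    by_contra! h
    have h1 := hp v hv0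
    rw [← hsum] at h1
    simp [h] at h1
  refine Finset.sum_pos' (fun i _ => mul_nonneg (inv_nonneg.2 (Real.sqrt_nonneg _))
    (mul_self_nonneg _)) ⟨i, Finset.mem_univ _, mul_pos (hterm i hi) (mul_self_pos.2 hi)⟩

/-- A subspace on which a symmetric form is positive definite is complemented by its orthogonal. -/
theorem isCompl_orthogonal_of_pos (hs : ∀ x y, b x y = b y x) {W : Submodule ℝ E}
    (hp : ∀ x ∈ W, x ≠ 0 → 0 < b x x) : IsCompl W (b.orthogonal W) := by
  have hr : b.IsRefl := fun x y h => by rw [hs, h]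
  refine LinearMap.BilinForm.isCompl_orthogonal_of_restrict_nondegenerate hr ?_
  refine nondegenerate_of_pos (fun x y => hs _ _) fun x hx => ?_
  exact hp x x.2 fun h => hx (Subtype.ext h)

/-- The range of a skew endomorphism is the orthogonal of its kernel. -/
theorem mem_range_of_skew (hs : ∀ x y, b x y = b y x) (hp : ∀ x, x ≠ 0 → 0 < b x x)
    {A : Module.End ℝ E} (hA : ∀ x y, b (A x) y = -b x (A y)) {v : E}
    (hv : ∀ z, A z = 0 → b v z = 0) : v ∈ LinearMap.range A := by
  have hr : b.IsRefl := fun x y h => by rw [hs, h]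
  rw [← LinearMap.BilinForm.orthogonal_orthogonal (nondegenerate_of_pos hs hp) hr
    (LinearMap.range A)]
  intro z hz
  change b z v = 0
  rw [hs]
  refine hv z ?_
  by_contra h
  refine (hp _ h).ne' ?_
  rw [← neg_eq_zero, ← hA]
  exact hz _ ⟨A z, rfl⟩

/-- The orthogonal of an invariant subspace is an invariant complement. -/
theorem isSemisimple_of_skew (hs : ∀ x y, b x y = b y x) (hp : ∀ x, x ≠ 0 → 0 < b x x)
    {A : Module.End ℝ E} (hA : ∀ x y, b (A x) y = -b x (A y)) : A.IsSemisimple := by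
  rw [Module.End.isSemisimple_iff]
  intro W hW
  refine ⟨b.orthogonal W, ?_, isCompl_orthogonal_of_pos hs fun x _ => hp x⟩
  rw [Module.End.mem_invtSubmodule] at hW ⊢
  intro x hx y hy
  have h1 : b (A y) x = 0 := hx _ (hW hy)
  rw [hA, neg_eq_zero] at h1
  exact h1

end SkewEndomorphism

/-! ### Differentiable families of conjugate semisimple elements -/

section Isospectral

variable {𝔸 : Type*} [NormedRing 𝔸] [NormedAlgebra ℝ 𝔸]

/-- Under a trace, and against elements commuting with `A 0`, a polynomial is differentiated as in
the commutative case. -/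
theorem exists_hasDerivAt_aeval {A : ℝ → 𝔸} {B : 𝔸} (hA : HasDerivAt A B 0) {τ : 𝔸 →ₗ[ℝ] ℝ}
    (hτ : ∀ x y, τ (x * y) = τ (y * x)) (p : Polynomial ℝ) :
    ∃ S, HasDerivAt (fun t => Polynomial.aeval (A t) p) S 0 ∧
      ∀ D, Commute D (A 0) →
        τ (S * D) = τ (B * Polynomial.aeval (A 0) (Polynomial.derivative p) * D) := by
  induction p using Polynomial.induction_on with
  | C a => exact ⟨0, by simpa using hasDerivAt_const (0 : ℝ) (algebraMap ℝ 𝔸 a), by simp⟩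
  | add p q hp hq =>
    obtain ⟨S, h, h'⟩ := hp
    obtain ⟨R, k, k'⟩ := hq
    refine ⟨S + R, by simpa using! h.add k, fun D hD => ?_⟩
    simp [add_mul, mul_add, h' D hD, k' D hD]
  | monomial n a hn =>
    obtain ⟨S, h, h'⟩ := hn
    rw [pow_succ, ← mul_assoc]
    set p := Polynomial.C a * Polynomial.X ^ n with hpdef
    refine ⟨S * A 0 + Polynomial.aeval (A 0) p * B, by simpa using! h.mul hA, fun D hD => ?_⟩
    have hc : Commute D (Polynomial.aeval (A 0) p) := by
      rw [hpdef]
      simpa using (show Commute D (algebraMap ℝ 𝔸 a) from (Algebra.commutes a D).symm).mul_right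
        (hD.pow_right n)
    have hd : Polynomial.aeval (A 0) (Polynomial.derivative (p * Polynomial.X)) =
        Polynomial.aeval (A 0) (Polynomial.derivative p) * A 0 + Polynomial.aeval (A 0) p := by
      simp
    rw [hd, add_mul, map_add, mul_assoc S, h' _ ((Commute.refl _).mul_left hD),
      mul_assoc _ B, hτ _ (B * D), mul_assoc B D, hc.eq]
    simp only [mul_add, add_mul, map_add, mul_assoc]

/-- A differentiable family of elements annihilated by the same separable polynomial has its
derivative at `0` orthogonal, for every trace, to the commutant of the element at `0`. Indeed
`0 = τ((p(A))' D') = τ(A' p'(A) D')` for `D'` in the commutant, and `p'(A)` is invertible there, by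
separability. -/
theorem trace_deriv_mul_eq_zero {A : ℝ → 𝔸} {B : 𝔸} (hA : HasDerivAt A B 0) {τ : 𝔸 →ₗ[ℝ] ℝ}
    (hτ : ∀ x y, τ (x * y) = τ (y * x)) {m : Polynomial ℝ} (hm : m.Separable)
    (h0 : ∀ t, Polynomial.aeval (A t) m = 0) {D : 𝔸} (hD : Commute D (A 0)) : τ (B * D) = 0 := by
  obtain ⟨S, hS, h⟩ := exists_hasDerivAt_aeval hA hτ m
  have hS0 : S = 0 := hS.unique (by simpa [h0] using hasDerivAt_const (0 : ℝ) (0 : 𝔸))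
  obtain ⟨r, s, hrs⟩ := hm
  have h1 : Polynomial.aeval (A 0) (Polynomial.derivative m) * Polynomial.aeval (A 0) s = 1 := by
    have h2 := congrArg (Polynomial.aeval (A 0)) hrs
    rw [map_add, map_mul, h0, mul_zero, zero_add, mul_comm s] at h2
    simpa using h2
  have hc : Commute (Polynomial.aeval (A 0) s) (A 0) := by
    have := (Polynomial.commute_X s).map (Polynomial.aeval (A 0) (R := ℝ))
    simpa using this.symm
  have h2 := h (Polynomial.aeval (A 0) s * D) (hc.mul_left hD)
  rw [hS0, zero_mul, map_zero, mul_assoc B, ← mul_assoc _ _ D, h1, one_mul] at h2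
  exact h2.symm

end Isospectral

/-! ### Submanifolds of a normed space: tangent spaces and flows -/

section Submanifold

variable {E : Type*} [NormedAddCommGroup E] [NormedSpace ℝ E]

/-- The tangent space at `q` of a subset `S` of a normed space: the span of the velocities at `q` of
the curves in `S`. -/
def tangentSpan (S : Set E) (q : E) : Submodule ℝ E :=
  Submodule.span ℝ {v | ∃ γ : ℝ → E, γ 0 = q ∧ (∀ t, γ t ∈ S) ∧ HasDerivAt γ v 0}

theorem tangentSpan_map_le {S T : Set E} {f : E →L[ℝ] E} (hf : MapsTo f S T) {q v : E}
    (hv : v ∈ tangentSpan S q) : f v ∈ tangentSpan T (f q) := by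
  have : tangentSpan S q ≤ (tangentSpan T (f q)).comap f.toLinearMap := by
    refine Submodule.span_le.2 ?_
    rintro v ⟨γ, h0, hγ, hd⟩
    refine Submodule.subset_span ⟨fun t => f (γ t), by simp [h0], fun t => hf (hγ t), ?_⟩
    exact f.hasFDerivAt.comp_hasDerivAt 0 hd
  exact this hv

section Chart

variable {S : Set E} {Φ : OpenPartialHomeomorph E E} {W : Submodule ℝ E}

theorem hasFDerivAt_chart (h1 : ContDiffOn ℝ ∞ Φ Φ.source) {q : E} (hq : q ∈ Φ.source) :
    HasFDerivAt Φ (fderiv ℝ Φ q) q :=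
  ((h1.contDiffAt (Φ.open_source.mem_nhds hq)).differentiableAt (by simp)).hasFDerivAt

theorem hasFDerivAt_chart_symm (h2 : ContDiffOn ℝ ∞ Φ.symm Φ.target) {q : E} (hq : q ∈ Φ.target) :
    HasFDerivAt Φ.symm (fderiv ℝ Φ.symm q) q :=
  ((h2.contDiffAt (Φ.open_target.mem_nhds hq)).differentiableAt (by simp)).hasFDerivAt

theorem fderiv_chart_symm_apply (h1 : ContDiffOn ℝ ∞ Φ Φ.source)
    (h2 : ContDiffOn ℝ ∞ Φ.symm Φ.target) {q : E} (hq : q ∈ Φ.source) (v : E) :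
    fderiv ℝ Φ.symm (Φ q) (fderiv ℝ Φ q v) = v := by
  have hc := (hasFDerivAt_chart_symm h2 (Φ.map_source hq)).comp q (hasFDerivAt_chart h1 hq)
  have hid : (Φ.symm ∘ Φ) =ᶠ[𝓝 q] id := by
    filter_upwards [Φ.open_source.mem_nhds hq] with x hx
    exact Φ.left_inv hx
  have := hc.unique ((hasFDerivAt_id q).congr_of_eventuallyEq hid)
  exact DFunLike.congr_fun this v

end Chart

variable [FiniteDimensional ℝ E]

theorem hasDerivAt_mem_submodule {f : ℝ → E} {v : E} {W : Submodule ℝ E} {t : ℝ}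
    (hf : HasDerivAt f v t) (hW : ∀ᶠ s in 𝓝 t, f s ∈ W) : v ∈ W := by
  have hcl : IsClosed (W : Set E) := W.closed_of_finiteDimensional
  refine hcl.mem_of_tendsto (hasDerivAt_iff_tendsto_slope.1 hf) ?_
  filter_upwards [eventually_nhdsWithin_of_eventually_nhds hW] with s hs
  rw [slope_def_module]
  exact W.smul_mem _ (W.sub_mem hs hW.self_of_nhds)

/-- If the flow of the linear vector field `A` preserves a subspace, so does `A`. -/
theorem mem_of_exp_smul_mem {A : E →L[ℝ] E} {W : Submodule ℝ E} {v : E}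
    (h : ∀ t : ℝ, NormedSpace.exp (t • A) v ∈ W) : A v ∈ W := by
  have h1 := (hasDerivAt_exp_smul_const (𝕂 := ℝ) A 0).clm_apply (hasDerivAt_const (0 : ℝ) v)
  have h2 : HasDerivAt (fun t : ℝ => NormedSpace.exp (t • A) v) (A v) 0 := by
    simpa [NormedSpace.exp_zero] using h1
  exact hasDerivAt_mem_submodule h2 (.of_forall h)

/-- A straightening chart maps tangent vectors into the linear model. -/
theorem fderiv_chart_mem {S : Set E} {Φ : OpenPartialHomeomorph E E} {W : Submodule ℝ E}
    (h1 : ContDiffOn ℝ ∞ Φ Φ.source)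
    (hS : ∀ x ∈ Φ.source, x ∈ S ↔ Φ x ∈ W) {q v : E} (hq : q ∈ Φ.source)
    (hv : v ∈ tangentSpan S q) : fderiv ℝ Φ q v ∈ W := by
  have : tangentSpan S q ≤ W.comap (fderiv ℝ Φ q).toLinearMap := by
    refine Submodule.span_le.2 ?_
    rintro v ⟨γ, rfl, hγ, hd⟩
    have hc := (hasFDerivAt_chart h1 hq).comp_hasDerivAt 0 hd
    change fderiv ℝ Φ (γ 0) v ∈ W
    refine hasDerivAt_mem_submodule hc ?_
    filter_upwards [hd.continuousAt.preimage_mem_nhds (Φ.open_source.mem_nhds hq)] with t ht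
    exact (hS _ ht).1 (hγ t)
  exact this hv

theorem IsSmoothSubmanifold.finrank_tangentSpan_le {d : ℕ} {S : Set E}
    (hS : IsSmoothSubmanifold d S) {q : E} (hq : q ∈ S) :
    Module.finrank ℝ (tangentSpan S q) ≤ d := by
  obtain ⟨Φ, W, hqΦ, h1, h2, rfl, hW⟩ := hS q hq
  let f : tangentSpan S q →ₗ[ℝ] W := ((fderiv ℝ Φ q).toLinearMap.comp
    (tangentSpan S q).subtype).codRestrict W fun v => fderiv_chart_mem h1 hW hqΦ v.2
  refine LinearMap.finrank_le_finrank_of_injective (f := f) fun v w hvw => ?_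
  have h3 : fderiv ℝ Φ q v = fderiv ℝ Φ q w := congrArg Subtype.val hvw
  have h4 := congrArg (fderiv ℝ Φ.symm (Φ q)) h3
  rw [fderiv_chart_symm_apply h1 h2 hqΦ, fderiv_chart_symm_apply h1 h2 hqΦ] at h4
  exact Subtype.ext h4

theorem exists_continuous_projection (W : Submodule ℝ E) :
    ∃ π : E →L[ℝ] W, ∀ w : W, π w = w := by
  obtain ⟨f, hf⟩ := LinearMap.exists_leftInverse_of_injective W.subtype W.ker_subtype
  exact ⟨LinearMap.toContinuousLinearMap f, fun w => LinearMap.congr_fun hf w⟩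

/-- Short-time invariance of a submanifold under a linear vector field tangent to it: the field is
integrated inside the submanifold, in a straightening chart, and the solution agrees with the
exponential by uniqueness. -/
theorem IsSmoothSubmanifold.eventually_exp_mem {d : ℕ} {S : Set E} (hS : IsSmoothSubmanifold d S)
    {A : E →L[ℝ] E} (hA : ∀ q ∈ S, A q ∈ tangentSpan S q) {q : E} (hq : q ∈ S) :
    ∀ᶠ t : ℝ in 𝓝 0, NormedSpace.exp (t • A) q ∈ S := by
  obtain ⟨Φ, W, hqΦ, h1, h2, -, hW⟩ := hS q hq
  obtain ⟨π, hπ⟩ := exists_continuous_projection W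
  have hw0 : Φ q ∈ W := (hW q hqΦ).1 hq
  let w0 : W := ⟨Φ q, hw0⟩
  -- the vector field on `W` obtained by straightening
  let u : W → W := fun w => π (fderiv ℝ Φ (Φ.symm w) (A (Φ.symm w)))
  have hu : ContDiffAt ℝ 1 u w0 := by
    have hs : ContDiffAt ℝ 2 (fun w : W => Φ.symm w) w0 := by
      have h3 : ContDiffAt ℝ 2 Φ.symm (Φ q) :=
        (h2.contDiffAt (Φ.open_target.mem_nhds (Φ.map_source hqΦ))).of_le (by norm_cast)
      exact ContDiffAt.comp (f := fun w : W => (w : E)) w0 h3 W.subtypeL.contDiff.contDiffAt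
    have hf : ContDiffAt ℝ 1 (fderiv ℝ Φ) (Φ.symm (w0 : E)) := by
      rw [show Φ.symm (w0 : E) = q from Φ.left_inv hqΦ]
      exact (h1.contDiffAt (Φ.open_source.mem_nhds hqΦ)).fderiv_right (by norm_cast)
    have hs1 : ContDiffAt ℝ 1 (fun w : W => Φ.symm w) w0 := hs.of_le (by norm_cast)
    exact π.contDiff.contDiffAt.comp w0
      ((ContDiffAt.comp w0 hf hs1).clm_apply (A.contDiff.contDiffAt.comp w0 hs1))
  obtain ⟨α, h0, hα⟩ := hu.exists_forall_mem_closedBall_exists_eq_forall_mem_Ioo_hasDerivAt₀ 0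
  obtain ⟨ε, hε, hα⟩ := hα
  have hαc : ContinuousAt α 0 := (hα 0 (by simpa using hε)).continuousAt
  have htar : ∀ᶠ t in 𝓝 (0 : ℝ), (α t : E) ∈ Φ.target := by
    refine (continuous_subtype_val.continuousAt.comp hαc).preimage_mem_nhds ?_
    refine Φ.open_target.mem_nhds ?_
    simpa [h0, w0] using Φ.map_source hqΦ
  have hint : ∀ᶠ t in 𝓝 (0 : ℝ), t ∈ Ioo (0 - ε) (0 + ε) :=
    Ioo_mem_nhds (by simpa using hε) (by simpa using hε)
  obtain ⟨δ, hδ, hball⟩ := Metric.eventually_nhds_iff_ball.1 (htar.and hint)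
  have hmem : ∀ t ∈ Metric.ball (0 : ℝ) δ, Φ.symm (α t : E) ∈ S := fun t ht => by
    have h3 := (hball t ht).1
    rw [hW _ (Φ.map_target h3), Φ.right_inv h3]
    exact (α t).2
  have hode : ∀ t ∈ Metric.ball (0 : ℝ) δ,
      HasDerivAt (fun t => Φ.symm (α t : E)) (A (Φ.symm (α t : E))) t := fun t ht => by
    obtain ⟨h3, h4⟩ := hball t ht
    have h5 : HasDerivAt (fun t => (α t : E)) (u (α t) : E) t :=
      W.subtypeL.hasFDerivAt.comp_hasDerivAt t (hα t h4)
    have h6 := (hasFDerivAt_chart_symm h2 h3).comp_hasDerivAt t h5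
    have h7 : fderiv ℝ Φ (Φ.symm (α t)) (A (Φ.symm (α t))) ∈ W :=
      fderiv_chart_mem h1 hW (Φ.map_target h3) (hA _ (hmem t ht))
    have h8 : (u (α t) : E) = fderiv ℝ Φ (Φ.symm (α t)) (A (Φ.symm (α t))) :=
      congrArg Subtype.val (hπ ⟨_, h7⟩)
    refine h6.congr_deriv ?_
    rw [h8]
    have h9 := fderiv_chart_symm_apply h1 h2 (Φ.map_target h3) (A (Φ.symm (α t)))
    rwa [Φ.right_inv h3] at h9
  filter_upwards [Metric.ball_mem_nhds (0 : ℝ) hδ] with t ht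
  have h3 := eq_exp_of_hasDerivAt (A := A) (f := fun t => Φ.symm (α t : E)) Metric.isOpen_ball
    (convex_ball (0 : ℝ) δ).isPreconnected (Metric.mem_ball_self hδ) hode ht
  have h4 : Φ.symm (α 0 : E) = q := by rw [h0]; exact Φ.left_inv hqΦ
  simp only [h4] at h3
  rw [← h3]
  exact hmem t ht

theorem exp_add_smul (A : E →L[ℝ] E) (s t : ℝ) (v : E) :
    NormedSpace.exp ((s + t) • A) v = NormedSpace.exp (s • A) (NormedSpace.exp (t • A) v) := by
  let _ : NormedAlgebra ℚ (E →L[ℝ] E) := NormedAlgebra.restrictScalars ℚ ℝ _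
  rw [add_smul, NormedSpace.exp_add_of_commute
    (((Commute.refl A).smul_left s).smul_right t)]
  rfl

theorem continuous_exp_smul (A : E →L[ℝ] E) (v : E) :
    Continuous fun t : ℝ => NormedSpace.exp (t • A) v :=
  continuous_iff_continuousAt.2 fun t =>
    ((hasDerivAt_exp_smul_const (𝕂 := ℝ) A t).clm_apply (hasDerivAt_const t v)).continuousAt

/-- A closed submanifold is invariant under the flow of a linear vector field tangent to it. -/
theorem IsSmoothSubmanifold.exp_mem {d : ℕ} {S : Set E} (hS : IsSmoothSubmanifold d S)
    (hc : IsClosed S) {A : E →L[ℝ] E} (hA : ∀ q ∈ S, A q ∈ tangentSpan S q) {q : E} (hq : q ∈ S)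
    (t : ℝ) : NormedSpace.exp (t • A) q ∈ S := by
  have hcl : IsClopen {t : ℝ | NormedSpace.exp (t • A) q ∈ S} := by
    refine ⟨hc.preimage (continuous_exp_smul A q), isOpen_iff_mem_nhds.2 fun t ht => ?_⟩
    have h1 : Tendsto (fun s : ℝ => s - t) (𝓝 t) (𝓝 0) := by
      simpa using (continuous_sub_right t).tendsto t
    filter_upwards [h1.eventually (hS.eventually_exp_mem hA ht)] with s hs
    rw [← exp_add_smul, sub_add_cancel] at hs
    exact hs
  have := hcl.eq_univ ⟨0, by simpa [NormedSpace.exp_zero] using hq⟩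
  exact eq_univ_iff_forall.1 this t

/-- A map into a `d`-dimensional submanifold whose differential has rank at least `d` covers a
neighbourhood in the submanifold: in a straightening chart it is a submersion. -/
theorem IsSmoothSubmanifold.range_mem_nhdsWithin {d : ℕ} {S : Set E}
    (hS : IsSmoothSubmanifold d S) {V : Type*} [NormedAddCommGroup V] [NormedSpace ℝ V]
    [FiniteDimensional ℝ V] {g : V → E} {g' : V →L[ℝ] E} (hg : HasStrictFDerivAt g g' 0)
    (hgS : ∀ x, g x ∈ S) (hd : d ≤ Module.finrank ℝ (LinearMap.range g'.toLinearMap)) :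
    range g ∈ 𝓝[S] (g 0) := by
  obtain ⟨Φ, W, hqΦ, h1, h2, hWd, hW⟩ := hS (g 0) (hgS 0)
  obtain ⟨π, hπ⟩ := exists_continuous_projection W
  have hΦ : HasStrictFDerivAt Φ (fderiv ℝ Φ (g 0)) (g 0) :=
    (h1.contDiffAt (Φ.open_source.mem_nhds hqΦ)).hasStrictFDerivAt (by simp)
  have htan : ∀ v, g' v ∈ tangentSpan S (g 0) := fun v => by
    refine Submodule.subset_span ⟨fun t : ℝ => g (t • v), by simp, fun t => hgS _, ?_⟩
    have h3 : HasDerivAt (fun t : ℝ => t • v) v 0 := by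
      simpa using (hasDerivAt_id (0 : ℝ)).smul_const v
    have h4 : HasFDerivAt g g' ((0 : ℝ) • v) := by simpa using hg.hasFDerivAt
    exact h4.comp_hasDerivAt (f := fun t : ℝ => t • v) 0 h3
  let L : V →L[ℝ] W := π.comp ((fderiv ℝ Φ (g 0)).comp g')
  have hL : ∀ v, (L v : E) = fderiv ℝ Φ (g 0) (g' v) := fun v =>
    congrArg Subtype.val (hπ ⟨_, fderiv_chart_mem h1 hW hqΦ (htan v)⟩)
  have hsurj : L.range = ⊤ := by
    refine Submodule.eq_top_of_finrank_eq (le_antisymm (Submodule.finrank_le _) ?_)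
    have h5 : (LinearMap.range L.toLinearMap).map W.subtype =
        (LinearMap.range g'.toLinearMap).map (fderiv ℝ Φ (g 0)).toLinearMap := by
      ext x
      constructor
      · rintro ⟨_, ⟨v, rfl⟩, rfl⟩
        exact ⟨g' v, ⟨v, rfl⟩, (hL v).symm⟩
      · rintro ⟨_, ⟨v, rfl⟩, rfl⟩
        exact ⟨L v, ⟨v, rfl⟩, hL v⟩
    have hinj : Function.Injective (fderiv ℝ Φ (g 0)).toLinearMap := fun v w hvw => by
      have h6 := congrArg (fderiv ℝ Φ.symm (Φ (g 0))) hvw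
      simpa [fderiv_chart_symm_apply h1 h2 hqΦ] using h6
    have h7 := congrArg (fun U : Submodule ℝ E => Module.finrank ℝ U) h5
    simp only [Submodule.finrank_map_subtype_eq] at h7
    rw [← (Submodule.equivMapOfInjective _ hinj _).finrank_eq] at h7
    rw [hWd]
    exact hd.trans h7.symm.le
  have hh : HasStrictFDerivAt (fun x => π (Φ (g x))) L 0 :=
    π.hasStrictFDerivAt.comp 0 (hΦ.comp 0 hg)
  have hmap := hh.map_nhds_eq_of_surj hsurj
  have hsrc : ∀ᶠ x in 𝓝 (0 : V), g x ∈ Φ.source :=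
    hg.continuousAt.preimage_mem_nhds (Φ.open_source.mem_nhds hqΦ)
  have himg : (fun x => π (Φ (g x))) '' {x | g x ∈ Φ.source} ∈ 𝓝 (π (Φ (g 0))) := by
    rw [← hmap]
    exact image_mem_map hsrc
  have hcont : ContinuousAt (fun s => π (Φ s)) (g 0) :=
    π.continuous.continuousAt.comp (Φ.continuousAt hqΦ)
  rw [mem_nhdsWithin_iff_eventually]
  filter_upwards [hcont.preimage_mem_nhds himg, Φ.open_source.mem_nhds hqΦ] with s hs hsΦ hsS
  obtain ⟨x, hx, hxs⟩ := hs
  have e1 : (π (Φ (g x)) : E) = Φ (g x) :=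
    congrArg Subtype.val (hπ ⟨_, (hW _ hx).1 (hgS x)⟩)
  have e2 : (π (Φ s) : E) = Φ s := congrArg Subtype.val (hπ ⟨_, (hW _ hsΦ).1 hsS⟩)
  have e3 : Φ (g x) = Φ s := by rw [← e1, ← e2]; exact congrArg Subtype.val hxs
  exact ⟨x, Φ.injOn hx hsΦ e3⟩

end Submanifold

/-! ### Conjugation and tangent spaces in coordinates -/

/-- Continuous endomorphisms form a subalgebra of the algebra of endomorphisms. -/
def toEndAlgHom (E : Type*) [NormedAddCommGroup E] [NormedSpace ℝ E] :
    (E →L[ℝ] E) →ₐ[ℝ] Module.End ℝ E :=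
  { ContinuousLinearMap.toLinearMapRingHom with commutes' := fun _ => rfl }

theorem aeval_semiconj {𝔸 : Type*} [Ring 𝔸] [Algebra ℝ 𝔸] {a c u : 𝔸} (h : c * u = u * a)
    (p : Polynomial ℝ) : Polynomial.aeval c p * u = u * Polynomial.aeval a p := by
  induction p using Polynomial.induction_on with
  | C r => simpa using Algebra.commutes r u
  | add p q hp hq => rw [map_add, map_add, add_mul, mul_add, hp, hq]
  | monomial n r hn =>
    rw [pow_succ, ← mul_assoc]
    set q := Polynomial.C r * Polynomial.X ^ n
    have hX : ∀ x : 𝔸, Polynomial.aeval x (q * Polynomial.X) = Polynomial.aeval x q * x := by simp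
    rw [hX, hX, mul_assoc, h, ← mul_assoc, hn, mul_assoc]

section Tangent

variable {N : ℕ} {G : Type*} [TopologicalSpace G] [ChartedSpace (EuclideanSpace ℝ (Fin N)) G]
  [Group G]

theorem map_coord_tangentL (L : Set (LieAlg N G)) (q : LieAlg N G) :
    (tangentL L q).map (coord (N := N) (G := G)).toLinearEquiv.toLinearMap =
      tangentSpan (coord '' L) (coord q) := by
  unfold tangentL tangentSpan
  rw [Submodule.map_span]
  congr 1
  ext v
  constructor
  · rintro ⟨w, ⟨γ, h0, hγ, hd⟩, rfl⟩
    exact ⟨fun t => coord (γ t), by simp [h0], fun t => mem_image_of_mem _ (hγ t), hd⟩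
  · rintro ⟨γ, h0, hγ, hd⟩
    refine ⟨coord.symm v, ⟨fun t => coord.symm (γ t), by simp [h0], fun t => ?_, by simpa using hd⟩,
      by simp⟩
    obtain ⟨x, hx, hx'⟩ := hγ t
    simpa [← hx'] using hx

theorem coord_mem_tangentSpan {L : Set (LieAlg N G)} {q v : LieAlg N G} :
    coord v ∈ tangentSpan (coord '' L) (coord q) ↔ v ∈ tangentL L q := by
  rw [← map_coord_tangentL]
  constructor
  · rintro ⟨w, hw, hwv⟩
    rwa [← (coord (N := N) (G := G)).injective hwv]
  · exact fun h => ⟨v, h, rfl⟩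

theorem finrank_tangentL (L : Set (LieAlg N G)) (q : LieAlg N G) :
    Module.finrank ℝ (tangentL L q) = Module.finrank ℝ (tangentSpan (coord '' L) (coord q)) := by
  rw [← map_coord_tangentL]
  exact ((coord (N := N) (G := G)).toLinearEquiv.submoduleMap _).finrank_eq

end Tangent

/-! ### The adjoint representation -/

section Adjoint

variable {N : ℕ} {G : Type*} [TopologicalSpace G] [ChartedSpace (EuclideanSpace ℝ (Fin N)) G]
  [Group G] [LieGroup (𝓡 N) ∞ G]

local notation "𝔼" => EuclideanSpace ℝ (Fin N)

theorem HasVelocity.conj {γ : ℝ → G} {X : LieAlg N G} (h : HasVelocity γ X) (g : G) :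
    HasVelocity (fun t => g * γ t * g⁻¹) (Ad g X) := by
  refine ⟨by simp [h.1], ?_⟩
  have hd : HasMFDerivAt (𝓡 N) (𝓡 N) (fun x : G => g * x * g⁻¹) 1 (AdE (N := N) g) :=
    ((contMDiff_conj (N := N) g).mdifferentiableAt (by simp)).hasMFDerivAt
  have hc := HasMFDerivAt.comp (x := (0 : ℝ)) (f := γ) (g := fun x : G => g * x * g⁻¹)
    (by rw [h.1]; exact hd) h.2
  refine hc.congr_mfderiv (ContinuousLinearMap.ext fun (t : ℝ) => ?_)
  exact map_smul (AdE (N := N) g) t (X : 𝔼)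

theorem adE_lie (X Y : LieAlg N G) : adE ⁅X, Y⁆ = adE X * adE Y - adE Y * adE X := by
  ext1 v
  obtain ⟨Z, rfl⟩ := (coord (N := N) (G := G)).surjective v
  simp only [ContinuousLinearMap.mul_def, ContinuousLinearMap.comp_apply,
    _root_.sub_apply, adE_coord, ← map_sub]
  rw [lie_lie]

variable (N G) in
/-- The adjoint representation of the Lie algebra, read in the model space. -/
def adLin : LieAlg N G →ₗ[ℝ] 𝔼 →L[ℝ] 𝔼 where
  toFun := adE
  map_add' X Y := by
    ext1 v
    obtain ⟨Z, rfl⟩ := (coord (N := N) (G := G)).surjective v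
    simp only [_root_.add_apply, adE_coord, add_lie, map_add]
  map_smul' c X := by
    ext1 v
    obtain ⟨Z, rfl⟩ := (coord (N := N) (G := G)).surjective v
    simp only [_root_.smul_apply, adE_coord, smul_lie, map_smul, RingHom.id_apply]

theorem trace_adE_mul (X Y : LieAlg N G) :
    LinearMap.trace ℝ 𝔼 (adE X * adE Y).toLinearMap = killingForm ℝ (LieAlg N G) X Y := by
  rw [killingForm_apply_apply, ← LinearMap.trace_conj' _ (coord (N := N) (G := G)).toLinearEquiv,
    LinearEquiv.conj_comp]
  rfl

theorem ip_comm (X Y : LieAlg N G) : ip X Y = ip Y X := by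
  unfold ip
  rw [LieModule.traceForm_comm]

theorem ip_ad_skew (Z X Y : LieAlg N G) : ip ⁅Z, X⁆ Y = -ip X ⁅Z, Y⁆ := by
  rw [← lie_skew, ← ip_lie]
  simp only [ip, map_neg, LinearMap.neg_apply]

variable (N G) in
/-- `⟨·, ·⟩` as a bilinear form. -/
def ipForm : LinearMap.BilinForm ℝ (LieAlg N G) := -killingForm ℝ (LieAlg N G)

theorem ipForm_apply (X Y : LieAlg N G) : ipForm N G X Y = ip X Y := rfl

theorem hasDerivAt_adE {γ : ℝ → LieAlg N G} {v : LieAlg N G}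
    (hd : HasDerivAt (fun t => coord (γ t)) (coord v) 0) :
    HasDerivAt (fun t => adE (γ t)) (adE v) 0 := by
  let F : 𝔼 →L[ℝ] (𝔼 →L[ℝ] 𝔼) := LinearMap.toContinuousLinearMap
    (adLin N G ∘ₗ (coord (N := N) (G := G)).symm.toLinearEquiv.toLinearMap)
  have hF : ∀ X, F (coord X) = adE X := fun X => rfl
  have h := F.hasFDerivAt.comp_hasDerivAt 0 hd
  rw [hF] at h
  exact h

/-- The adjoint representation of a semisimple Lie algebra is faithful. -/
theorem adE_ne_zero [LieAlgebra.HasTrivialRadical ℝ (LieAlg N G)] {X : LieAlg N G} (hX : X ≠ 0) :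
    adE X ≠ 0 := by
  intro h
  refine hX ((LieModule.isFaithful_iff' ℝ (LieAlg N G) (LieAlg N G)).1 inferInstance X fun Y => ?_)
  have h1 := adE_coord X Y
  rw [h] at h1
  simpa using h1.symm

variable [T2Space G]

/-- `Ad g` is an automorphism of `𝔤`: differentiate `Ad (g γ(t) g⁻¹) = Ad g ∘ Ad (γ t) ∘ Ad g⁻¹`
along a one-parameter subgroup `γ`. -/
theorem Ad_lie (g : G) (X Y : LieAlg N G) : Ad g ⁅X, Y⁆ = ⁅Ad g X, Ad g Y⁆ := by
  obtain ⟨γ, -, hγ, -⟩ := exists_oneParameter X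
  have h1 := (hγ.conj g).hasDerivAt_AdE (coord (Ad g Y))
  have h2 : HasDerivAt (fun t => AdE (g * γ t * g⁻¹) (coord (Ad g Y)))
      (AdE g (adE X (coord Y))) 0 := by
    have h3 := (AdE (N := N) g).hasFDerivAt.comp_hasDerivAt 0 (hγ.hasDerivAt_AdE (coord Y))
    refine h3.congr_of_eventuallyEq (.of_forall fun t => ?_)
    have h4 : AdE (N := N) g⁻¹ (coord (Ad g Y)) = coord Y := by
      rw [← coord_Ad, ← Ad_mul, inv_mul_cancel, Ad_one]
    simp only [AdE_mul, ContinuousLinearMap.comp_apply, h4, Function.comp_apply]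
  have h5 := h2.unique h1
  rw [adE_coord, adE_coord, ← coord_Ad] at h5
  exact (coord (N := N) (G := G)).injective h5

theorem adE_Ad (g : G) (X : LieAlg N G) : adE (Ad g X) * AdE g = AdE g * adE X := by
  ext1 v
  obtain ⟨Y, rfl⟩ := (coord (N := N) (G := G)).surjective v
  simp only [ContinuousLinearMap.mul_def, ContinuousLinearMap.comp_apply, ← coord_Ad, adE_coord,
    Ad_lie]

/-- The Lie algebra of the isotropy group of `ξ` is the centralizer of `ξ`. -/
theorem mem_lieAlgOf_isotropy {ξ X : LieAlg N G} :
    X ∈ lieAlgOf N (isotropy ξ) ↔ ⁅X, ξ⁆ = 0 := by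
  constructor
  · rintro ⟨γ, hγ, hv⟩
    have h1 := hv.hasDerivAt_AdE (coord ξ)
    have h2 : (fun t => AdE (γ t) (coord ξ)) = fun _ => coord ξ := by
      ext1 t
      rw [← coord_Ad, show Ad (γ t) ξ = ξ from hγ t]
    rw [h2] at h1
    have h3 := h1.unique (hasDerivAt_const (0 : ℝ) (coord ξ))
    rw [adE_coord] at h3
    simpa using h3
  · intro h
    obtain ⟨γ, -, hγ, hexp⟩ := exists_oneParameter X
    refine ⟨γ, fun t => ?_, hγ⟩
    have h1 : adE X (coord ξ) = 0 := by rw [adE_coord, h, map_zero]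
    have h2 := eq_exp_of_hasDerivAt (A := adE X) (f := fun _ => coord ξ) isOpen_univ
      isPreconnected_univ (mem_univ 0) (fun t _ => by rw [h1]; exact hasDerivAt_const _ _)
      (mem_univ t)
    change Ad (γ t) ξ = ξ
    refine (coord (N := N) (G := G)).injective ?_
    rw [coord_Ad, hexp]
    exact h2.symm

/-! ### Definiteness of the Killing form -/

section Compact

variable [CompactSpace G]

variable (N G) in
/-- An invariant inner product, obtained by averaging that of the model space over `G`. -/
theorem exists_Ad_invariant_form : ∃ b : LinearMap.BilinForm ℝ 𝔼,
    (∀ x y, b x y = b y x) ∧ (∀ x, x ≠ 0 → 0 < b x x) ∧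
      ∀ (g : G) x y, b (AdE g x) (AdE g y) = b x y := by
  have : IsTopologicalGroup G := topologicalGroup_of_lieGroup (𝓡 N) ∞
  let _ : MeasurableSpace G := borel G
  have : BorelSpace G := ⟨rfl⟩
  let μ : MeasureTheory.Measure G := MeasureTheory.Measure.haar
  let f : 𝔼 → 𝔼 → G → ℝ := fun x y g => inner ℝ (AdE g⁻¹ x) (AdE g⁻¹ y)
  have hc : ∀ x : 𝔼, Continuous fun g : G => AdE g⁻¹ x := fun x =>
    (continuous_AdE_apply x).comp continuous_inv
  have hf : ∀ x y, Continuous (f x y) := fun x y => (hc x).inner (hc y)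
  have hi : ∀ x y, MeasureTheory.Integrable (f x y) μ := fun x y =>
    (hf x y).integrable_of_hasCompactSupport (.of_compactSpace _)
  refine ⟨LinearMap.mk₂ ℝ (fun x y => ∫ g, f x y g ∂μ) ?_ ?_ ?_ ?_, ?_, ?_, ?_⟩
  · intro x x' y
    rw [← MeasureTheory.integral_add (hi _ _) (hi _ _)]
    simp only [f, map_add, inner_add_left]
  · intro c x y
    rw [smul_eq_mul, ← MeasureTheory.integral_const_mul]
    simp only [f, map_smul, real_inner_smul_left]
  · intro x y y'
    rw [← MeasureTheory.integral_add (hi _ _) (hi _ _)]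
    simp only [f, map_add, inner_add_right]
  · intro c x y
    rw [smul_eq_mul, ← MeasureTheory.integral_const_mul]
    simp only [f, map_smul, real_inner_smul_right]
  · intro x y
    simp only [LinearMap.mk₂_apply, f, real_inner_comm]
  · intro x hx
    rw [LinearMap.mk₂_apply]
    refine (hf x x).integral_pos_of_hasCompactSupport_nonneg_nonzero (.of_compactSpace _)
      (fun g => real_inner_self_nonneg) (x := (1 : G)) ?_
    simp only [f, inv_one, AdE_one]
    simpa using hx
  · intro h x y
    simp only [LinearMap.mk₂_apply]
    rw [← MeasureTheory.integral_mul_left_eq_self (f x y) h⁻¹]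
    refine congrArg (MeasureTheory.integral μ) (funext fun g => ?_)
    simp only [f, ← ContinuousLinearMap.comp_apply, ← AdE_mul, mul_inv_rev, inv_inv]

variable (N G) in
/-- The operators `ad X` are skew for an `Ad`-invariant inner product. -/
theorem exists_ad_skew_form : ∃ b : LinearMap.BilinForm ℝ 𝔼,
    (∀ x y, b x y = b y x) ∧ (∀ x, x ≠ 0 → 0 < b x x) ∧
      ∀ (X : LieAlg N G) x y, b (adE X x) y = -b x (adE X y) := by
  obtain ⟨b, hs, hp, hb⟩ := exists_Ad_invariant_form N G
  refine ⟨b, hs, hp, fun X x y => ?_⟩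
  obtain ⟨γ, -, hγ, -⟩ := exists_oneParameter X
  let B : 𝔼 →L[ℝ] 𝔼 →L[ℝ] ℝ := LinearMap.toContinuousLinearMap
    ((LinearMap.toContinuousLinearMap : (𝔼 →ₗ[ℝ] ℝ) ≃ₗ[ℝ] 𝔼 →L[ℝ] ℝ).toLinearMap ∘ₗ b)
  have hB : ∀ x y, B x y = b x y := fun x y => rfl
  have h1 : HasDerivAt (fun t => B (AdE (γ t) x)) (B (adE X x)) 0 :=
    B.hasFDerivAt.comp_hasDerivAt 0 (hγ.hasDerivAt_AdE x)
  have h2 := h1.clm_apply (hγ.hasDerivAt_AdE y)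
  simp only [hB, hb, hγ.1, AdE_one, ContinuousLinearMap.id_apply] at h2
  have h3 := h2.unique (hasDerivAt_const (0 : ℝ) (b x y))
  linarith

variable [LieAlgebra.HasTrivialRadical ℝ (LieAlg N G)]

/-- The Killing form of a compact semisimple Lie group is negative definite, as `ad X` is skew for
an invariant inner product. -/
theorem ip_pos {X : LieAlg N G} (hX : X ≠ 0) : 0 < ip X X := by
  obtain ⟨b, hs, hp, hb⟩ := exists_ad_skew_form N G
  have h1 := trace_sq_neg_of_skew hs hp (A := (adE X).toLinearMap) (hb X) fun h =>
    adE_ne_zero hX (ContinuousLinearMap.coe_injective h)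
  have h2 := trace_adE_mul X X
  unfold ip
  rw [← h2]
  exact neg_pos.2 h1

end Compact

/-! ### Tangent spaces of a subset of the flag manifold -/

/-- The operators `ad q` along an adjoint orbit have the same annihilating polynomials. -/
theorem aeval_adE_Ad_eq_zero {p : Polynomial ℝ} {ξ : LieAlg N G}
    (h : Polynomial.aeval (adE ξ) p = 0) (g : G) : Polynomial.aeval (adE (Ad g ξ)) p = 0 := by
  have h1 := aeval_semiconj (adE_Ad g ξ) p
  rw [h, mul_zero] at h1
  have h2 : AdE (N := N) g * AdE g⁻¹ = 1 := by
    rw [ContinuousLinearMap.mul_def, ← AdE_mul, mul_inv_cancel, AdE_one]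
    rfl
  rw [← mul_one (Polynomial.aeval (adE (Ad g ξ)) p), ← h2, ← mul_assoc, h1, zero_mul]

theorem exists_separable_aeval_adE [CompactSpace G] (ξ : LieAlg N G) :
    ∃ m : Polynomial ℝ, m.Separable ∧ Polynomial.aeval (adE ξ) m = 0 := by
  obtain ⟨b, hs, hp, hb⟩ := exists_ad_skew_form N G
  refine ⟨minpoly ℝ (adE ξ).toLinearMap, PerfectField.separable_iff_squarefree.2
    (isSemisimple_of_skew hs hp (hb ξ)).minpoly_squarefree, ?_⟩
  refine ContinuousLinearMap.coe_injective ?_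
  have h1 := Polynomial.aeval_algHom_apply (toEndAlgHom 𝔼) (adE ξ) (minpoly ℝ (adE ξ).toLinearMap)
  refine h1.symm.trans ?_
  exact minpoly.aeval ℝ (adE ξ).toLinearMap

/-- A curve `γ` in an adjoint orbit has velocity at `q = γ 0` orthogonal to the centralizer of `q`:
the operators `ad (γ t)` are conjugate and semisimple, so that the derivative of `ad (γ t)` is
trace-orthogonal to the commutant of `ad q`. -/
theorem ip_velocity_eq_zero [CompactSpace G] {ξ : LieAlg N G} {γ : ℝ → LieAlg N G}
    (hγ : ∀ t, γ t ∈ flagManifold ξ) {v Z : LieAlg N G}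
    (hd : HasDerivAt (fun t => coord (γ t)) (coord v) 0) (hZ : ⁅γ 0, Z⁆ = 0) : ip v Z = 0 := by
  obtain ⟨m, hsep, hm0⟩ := exists_separable_aeval_adE ξ
  have hconj : ∀ t, Polynomial.aeval (adE (γ t)) m = 0 := fun t => by
    obtain ⟨g, hg⟩ := hγ t
    rw [hg]
    exact aeval_adE_Ad_eq_zero hm0 g
  let τ : (𝔼 →L[ℝ] 𝔼) →ₗ[ℝ] ℝ :=
    LinearMap.trace ℝ 𝔼 ∘ₗ (toEndAlgHom 𝔼).toLinearMap
  have hτ : ∀ x y, τ (x * y) = τ (y * x) := fun x y =>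
    LinearMap.trace_mul_comm ℝ x.toLinearMap y.toLinearMap
  have hcomm : Commute (adE Z) (adE (γ 0)) := by
    have h2 := adE_lie (γ 0) Z
    rw [hZ, show adE (0 : LieAlg N G) = 0 from (adLin N G).map_zero] at h2
    exact (sub_eq_zero.1 h2.symm).symm
  have h3 : τ (adE v * adE Z) = 0 :=
    trace_deriv_mul_eq_zero (hasDerivAt_adE hd) hτ hsep hconj hcomm
  have h4 : τ (adE v * adE Z) = killingForm ℝ (LieAlg N G) v Z := trace_adE_mul v Z
  rw [ip, ← h4, h3, neg_zero]

theorem mem_tangentM_of_ip [CompactSpace G] [LieAlgebra.HasTrivialRadical ℝ (LieAlg N G)]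
    {q v : LieAlg N G} (h : ∀ Z, ⁅q, Z⁆ = 0 → ip v Z = 0) : v ∈ tangentM q :=
  mem_range_of_skew (b := ipForm N G) (A := LieAlgebra.ad ℝ (LieAlg N G) q) ip_comm
    (fun _ hx => ip_pos hx) (ip_ad_skew q) h

/-- `T_qL ⊆ T_qM`: since `⟨·, ·⟩` is definite and `ad q` is skew, `T_qM = range (ad q)` is the
orthogonal of the centralizer of `q`. -/
theorem tangentL_le_tangentM [CompactSpace G] [LieAlgebra.HasTrivialRadical ℝ (LieAlg N G)]
    {ξ : LieAlg N G} {L : Set (LieAlg N G)} (hL : L ⊆ flagManifold ξ) (q : LieAlg N G) :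
    tangentL L q ≤ tangentM q := by
  refine Submodule.span_le.2 ?_
  rintro v ⟨γ, rfl, hγ, hd⟩
  exact mem_tangentM_of_ip fun Z hZ => ip_velocity_eq_zero (fun t => hL (hγ t)) hd hZ

end Adjoint

/-! ### The normal projection and the kernel of `σ` -/

section Normal

variable {N : ℕ} {G : Type*} [TopologicalSpace G] [ChartedSpace (EuclideanSpace ℝ (Fin N)) G]
  [Group G] [LieGroup (𝓡 N) ∞ G]

/-- `(-(ad q)²)^{-1/2}`, so that `J_q = ad q ∘ sqrtInv q`. -/
def sqrtInv (q : LieAlg N G) : Module.End ℝ (LieAlg N G) :=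
  Polynomial.aeval (LieAlgebra.ad ℝ (LieAlg N G) q * LieAlgebra.ad ℝ (LieAlg N G) q)
    (sqrtInvPoly (LieAlgebra.ad ℝ (LieAlg N G) q * LieAlgebra.ad ℝ (LieAlg N G) q))

theorem complexStructure_eq (q v : LieAlg N G) :
    complexStructure q v = ⁅q, sqrtInv q v⁆ := rfl

/-- Writing `v = [X, q]`, invariance of `⟨·, ·⟩` turns `⟨X, J_q w⟩` into `⟨v, sqrtInv q w⟩`. -/
theorem kahlerMetric_eq_sqrtInv {q v w : LieAlg N G} (hv : v ∈ tangentM q) :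
    kahlerMetric q v w = ip v (sqrtInv q w) := by
  rw [kahlerMetric_eq_ip, complexStructure_eq, ← ip_lie]
  exact congrArg (fun z => ip z (sqrtInv q w))
    (Classical.epsilon_spec (p := fun X => fundamentalField X q = v) (mem_tangentM.1 hv))

/-- The symmetric form `⟨·, sqrtInv q ·⟩`, which is the Kähler metric on `T_qM`. -/
def metricForm (q : LieAlg N G) : LinearMap.BilinForm ℝ (LieAlg N G) :=
  (ipForm N G).compRight (sqrtInv q)

theorem metricForm_apply (q v w : LieAlg N G) : metricForm q v w = ip v (sqrtInv q w) := rfl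

theorem metricForm_symm (q v w : LieAlg N G) : metricForm q v w = metricForm q w v := by
  rw [metricForm_apply, metricForm_apply, ip_comm w]
  refine (aeval_symm (b := ipForm N G) (fun x y => ?_) _ v w).symm
  simp only [ipForm_apply, Module.End.mul_apply, LieAlgebra.ad_apply, ip_ad_skew, neg_neg]

variable [T2Space G] [CompactSpace G] [LieAlgebra.HasTrivialRadical ℝ (LieAlg N G)]

/-- The Kähler metric is positive definite on `T_qM`, the range of the skew operator `ad q`. -/
theorem metricForm_pos {q v : LieAlg N G} (hv : v ∈ tangentM q) (hv0 : v ≠ 0) :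
    0 < metricForm q v v :=
  sqrtInvPoly_pos (b := ipForm N G) (A := LieAlgebra.ad ℝ (LieAlg N G) q) ip_comm
    (fun _ hx => ip_pos hx) (ip_ad_skew q) hv hv0

variable {ξ : LieAlg N G} {L : Set (LieAlg N G)}

/-- The normal vectors are those of the orthogonal of `T_qL` for `metricForm q` that lie in
`T_qM`. -/
theorem isNormal_iff (hL : L ⊆ flagManifold ξ) {q w : LieAlg N G} :
    IsNormal L q w ↔ w ∈ tangentM q ∧ w ∈ (metricForm q).orthogonal (tangentL L q) := by
  refine and_congr_right fun _ => forall₂_congr fun v hv => ?_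
  rw [kahlerMetric_eq_sqrtInv (tangentL_le_tangentM hL q hv)]
  rfl

theorem isCompl_tangentL (hL : L ⊆ flagManifold ξ) (q : LieAlg N G) :
    IsCompl (tangentL L q) ((metricForm q).orthogonal (tangentL L q)) :=
  isCompl_orthogonal_of_pos (metricForm_symm q) fun _ hx =>
    metricForm_pos (tangentL_le_tangentM hL q hx)

theorem exists_isNormal_sub_mem (hL : L ⊆ flagManifold ξ) {q u : LieAlg N G}
    (hu : u ∈ tangentM q) : ∃ s, IsNormal L q s ∧ u - s ∈ tangentL L q := by
  have h1 : u ∈ tangentL L q ⊔ (metricForm q).orthogonal (tangentL L q) := by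
    rw [(isCompl_tangentL hL q).sup_eq_top]
    trivial
  obtain ⟨t, ht, s, hs, rfl⟩ := Submodule.mem_sup.1 h1
  refine ⟨s, (isNormal_iff hL).2 ⟨?_, hs⟩, by simpa using ht⟩
  simpa using Submodule.sub_mem _ hu (tangentL_le_tangentM hL q ht)

theorem IsNormal.eq_zero (hL : L ⊆ flagManifold ξ) {q s : LieAlg N G} (hs : IsNormal L q s)
    (hs' : s ∈ tangentL L q) : s = 0 := by
  have h1 : s ∈ tangentL L q ⊓ (metricForm q).orthogonal (tangentL L q) :=
    ⟨hs', ((isNormal_iff hL).1 hs).2⟩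
  rwa [(isCompl_tangentL hL q).inf_eq_bot] at h1

theorem IsNormal.unique (hL : L ⊆ flagManifold ξ) {q u s s' : LieAlg N G} (hs : IsNormal L q s)
    (hs' : IsNormal L q s') (h : u - s ∈ tangentL L q) (h' : u - s' ∈ tangentL L q) : s = s' := by
  have h1 := Submodule.sub_mem _ h' h
  rw [sub_sub_sub_cancel_left] at h1
  have h2 : IsNormal L q (s - s') := by
    have := hs.add (hs'.smul (-1))
    rwa [neg_one_smul, ← sub_eq_add_neg] at this
  exact sub_eq_zero.1 (h2.eq_zero hL h1)

theorem exists_isSigma (hL : L ⊆ flagManifold ξ) (X : LieAlg N G) : ∃ s, IsSigma L X s := by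
  have h : ∀ q : L, ∃ s, IsNormal L q s ∧ fundamentalField X q - s ∈ tangentL L q := fun q =>
    exists_isNormal_sub_mem hL (mem_tangentM.2 ⟨X, rfl⟩)
  choose s hs using h
  exact ⟨s, hs⟩

theorem IsSigma.unique (hL : L ⊆ flagManifold ξ) {X : LieAlg N G} {s s' : L → LieAlg N G}
    (hs : IsSigma L X s) (hs' : IsSigma L X s') : s = s' :=
  funext fun q => (hs q).1.unique hL (hs' q).1 (hs q).2 (hs' q).2

variable (L) in
/-- The subspace of those `X ∈ 𝔤` for which `X^*` is tangent to `L`: the kernel of `σ`. -/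
def tangentAlg : Submodule ℝ (LieAlg N G) where
  carrier := {X | ∀ q ∈ L, fundamentalField X q ∈ tangentL L q}
  zero_mem' q _ := by simp [fundamentalField]
  add_mem' {X Y} hX hY q hq := by
    rw [fundamentalField, add_lie]
    exact Submodule.add_mem _ (hX q hq) (hY q hq)
  smul_mem' c X hX q hq := by
    rw [fundamentalField, smul_lie]
    exact Submodule.smul_mem _ c (hX q hq)

/-- The linear map `σ : 𝔤 → Γ(νL)`. -/
def sigmaMap (hL : L ⊆ flagManifold ξ) : LieAlg N G →ₗ[ℝ] L → LieAlg N G where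
  toFun X := (exists_isSigma hL X).choose
  map_add' X Y := by
    refine IsSigma.unique hL (exists_isSigma hL (X + Y)).choose_spec fun q => ?_
    have hX := (exists_isSigma hL X).choose_spec q
    have hY := (exists_isSigma hL Y).choose_spec q
    refine ⟨hX.1.add hY.1, ?_⟩
    have := Submodule.add_mem _ hX.2 hY.2
    rwa [sub_add_sub_comm, fundamentalField, fundamentalField, ← add_lie] at this
  map_smul' c X := by
    refine IsSigma.unique hL (exists_isSigma hL (c • X)).choose_spec fun q => ?_
    have hX := (exists_isSigma hL X).choose_spec q
    refine ⟨hX.1.smul c, ?_⟩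
    have := Submodule.smul_mem _ c hX.2
    rwa [smul_sub, fundamentalField, ← smul_lie] at this

theorem isSigma_sigmaMap (hL : L ⊆ flagManifold ξ) (X : LieAlg N G) :
    IsSigma L X (sigmaMap hL X) :=
  (exists_isSigma hL X).choose_spec

theorem range_sigmaMap (hL : L ⊆ flagManifold ξ) : LinearMap.range (sigmaMap hL) = spaceV L := by
  ext s
  constructor
  · rintro ⟨X, rfl⟩
    exact ⟨X, isSigma_sigmaMap hL X⟩
  · rintro ⟨X, hX⟩
    exact ⟨X, (isSigma_sigmaMap hL X).unique hL hX⟩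

theorem ker_sigmaMap (hL : L ⊆ flagManifold ξ) : LinearMap.ker (sigmaMap hL) = tangentAlg L := by
  ext X
  rw [LinearMap.mem_ker]
  constructor
  · intro h q hq
    have h1 := (isSigma_sigmaMap hL X ⟨q, hq⟩).2
    rw [h] at h1
    simpa using h1
  · intro h
    exact (isSigma_sigmaMap hL X).unique hL fun q =>
      ⟨IsNormal.zero L q, by simpa using h q q.2⟩

theorem finrank_spaceV_add (hL : L ⊆ flagManifold ξ) :
    Module.finrank ℝ (spaceV L) + Module.finrank ℝ (tangentAlg L) =
      Module.finrank ℝ (LieAlg N G) := by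
  rw [← range_sigmaMap hL, ← ker_sigmaMap hL]
  exact LinearMap.finrank_range_add_finrank_ker (sigmaMap hL)

end Normal

/-! ### The stabilizer of a Lagrangian submanifold -/

section Stabilizer

variable {N : ℕ} {G : Type*} [TopologicalSpace G] [ChartedSpace (EuclideanSpace ℝ (Fin N)) G]
  [Group G] [LieGroup (𝓡 N) ∞ G]

local notation "𝔼" => EuclideanSpace ℝ (Fin N)

theorem mem_setStabilizer_iff {L : Set (LieAlg N G)} {g : G} :
    g ∈ setStabilizer L ↔ (∀ x ∈ L, Ad g x ∈ L) ∧ ∀ x ∈ L, Ad g⁻¹ x ∈ L := by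
  constructor
  · intro h
    have h' := (setStabilizer L).inv_mem h
    exact ⟨fun x hx => (show (fun q => Ad g q) '' L = L from h) ▸ mem_image_of_mem _ hx,
      fun x hx => (show (fun q => Ad g⁻¹ q) '' L = L from h') ▸ mem_image_of_mem _ hx⟩
  · rintro ⟨h1, h2⟩
    refine Subset.antisymm (image_subset_iff.2 h1) fun x hx => ⟨_, h2 x hx, ?_⟩
    simp only [← Ad_mul, mul_inv_cancel, Ad_one]

theorem Ad_mem_of_mem_stabComponent {L : Set (LieAlg N G)} {g : G} (hg : g ∈ stabComponent L)
    {x : LieAlg N G} (hx : x ∈ L) : Ad g x ∈ L := by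
  obtain ⟨k, -, rfl⟩ := hg
  exact (mem_setStabilizer_iff.1 k.2).1 x hx

theorem isClosed_setStabilizer {L : Set (LieAlg N G)} (hL : IsClosed (coord '' L)) :
    IsClosed (setStabilizer L : Set G) := by
  have : IsTopologicalGroup G := topologicalGroup_of_lieGroup (𝓡 N) ∞
  have hmem : ∀ x, coord x ∈ coord '' L ↔ x ∈ L := fun x =>
    (coord (N := N) (G := G)).injective.mem_set_image
  have h1 : (setStabilizer L : Set G) = ⋂ x ∈ L,
      ({g | AdE g (coord x) ∈ coord '' L} ∩ {g | AdE g⁻¹ (coord x) ∈ coord '' L}) := by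
    ext g
    simp only [SetLike.mem_coe, mem_setStabilizer_iff, mem_iInter, mem_inter_iff, mem_ofPred_eq,
      ← coord_Ad, hmem, forall_and]
  rw [h1]
  refine isClosed_biInter fun x _ => (hL.preimage (continuous_AdE_apply _)).inter ?_
  exact hL.preimage ((continuous_AdE_apply (coord x)).comp continuous_inv)

theorem isClosed_stabComponent {L : Set (LieAlg N G)} (hL : IsClosed (coord '' L)) :
    IsClosed (stabComponent L : Set G) := by
  have : IsTopologicalGroup G := topologicalGroup_of_lieGroup (𝓡 N) ∞
  exact (isClosed_setStabilizer hL).isClosedEmbedding_subtypeVal.isClosedMap _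
    (isClosed_connectedComponent (x := (1 : setStabilizer L)))

theorem mem_stabComponent_of_curve {L : Set (LieAlg N G)} {γ : ℝ → G} (hγ : Continuous γ)
    (h0 : γ 0 = 1) (h : ∀ t, γ t ∈ setStabilizer L) (t : ℝ) : γ t ∈ stabComponent L := by
  have : IsTopologicalGroup G := topologicalGroup_of_lieGroup (𝓡 N) ∞
  let δ : ℝ → setStabilizer L := fun t => ⟨γ t, h t⟩
  have hδ : Continuous δ := hγ.subtype_mk h
  have h1 : range δ ⊆ connectedComponent (1 : setStabilizer L) :=
    (isPreconnected_range hδ).subset_connectedComponent ⟨0, Subtype.ext h0⟩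
  exact ⟨δ t, h1 (mem_range_self t), rfl⟩

variable {ξ : LieAlg N G} {d : ℕ} {L : Set (LieAlg N G)}

theorem IsCompactLagrangian.isClosed_coord_image (hL : IsCompactLagrangian ξ d L) :
    IsClosed (coord '' L) :=
  (hL.isCompact.image (coord (N := N) (G := G)).continuous).isClosed

theorem IsCompactLagrangian.exp_mem (hL : IsCompactLagrangian ξ d L) {X : LieAlg N G}
    (hX : X ∈ tangentAlg L) {v : 𝔼} (hv : v ∈ coord '' L) (t : ℝ) :
    NormedSpace.exp (t • adE X) v ∈ coord '' L := by
  refine hL.isSmoothSubmanifold.exp_mem hL.isClosed_coord_image ?_ hv t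
  rintro _ ⟨q, hq, rfl⟩
  rw [adE_coord, coord_mem_tangentSpan]
  exact hX q hq

/-- Evaluation at `ξ` of the fields induced by the elements of `tangentAlg L`. -/
def evalTangent (ξ : LieAlg N G) (L : Set (LieAlg N G)) : tangentAlg L →ₗ[ℝ] LieAlg N G :=
  (-(LieAlgebra.ad ℝ (LieAlg N G) ξ)) ∘ₗ (tangentAlg L).subtype

theorem evalTangent_apply (X : tangentAlg L) : evalTangent ξ L X = ⁅(X : LieAlg N G), ξ⁆ := by
  simp [evalTangent]

/-- If `X^*` is tangent to `L` and vanishes at `ξ`, its flow `exp (t ad X)` preserves `L` and fixes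
`ξ`, hence preserves `T_ξL`. -/
theorem IsCompactLagrangian.lie_mem_tangentL (hL : IsCompactLagrangian ξ d L) {X : LieAlg N G}
    (hX : X ∈ tangentAlg L) (hXξ : ⁅X, ξ⁆ = 0) {v : LieAlg N G} (hv : v ∈ tangentL L ξ) :
    ⁅X, v⁆ ∈ tangentL L ξ := by
  rw [← coord_mem_tangentSpan, ← adE_coord]
  rw [← coord_mem_tangentSpan] at hv
  refine mem_of_exp_smul_mem fun t => ?_
  have h1 := tangentSpan_map_le (f := NormedSpace.exp (t • adE X))
    (fun x hx => hL.exp_mem hX hx t) hv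
  have h3 := eq_exp_of_hasDerivAt (A := adE X) (f := fun _ => coord ξ) isOpen_univ
    isPreconnected_univ (mem_univ 0)
    (fun t _ => by rw [adE_coord, hXξ, map_zero]; exact hasDerivAt_const _ _) (mem_univ t)
  rwa [← h3] at h1

theorem IsCompactLagrangian.finrank_range_evalTangent_le (hL : IsCompactLagrangian ξ d L)
    (hξ : ξ ∈ L) : Module.finrank ℝ (LinearMap.range (evalTangent ξ L)) ≤ d := by
  have h1 : LinearMap.range (evalTangent ξ L) ≤ tangentL L ξ := by
    rintro _ ⟨X, rfl⟩
    rw [evalTangent_apply]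
    exact X.2 ξ hξ
  refine (Submodule.finrank_mono h1).trans ?_
  rw [finrank_tangentL]
  exact hL.isSmoothSubmanifold.finrank_tangentSpan_le (mem_image_of_mem _ hξ)

variable [T2Space G]

theorem mem_spaceM_iff {X : LieAlg N G} : X ∈ spaceM ξ ↔ ∀ U, ⁅U, ξ⁆ = 0 → ip U X = 0 := by
  refine ⟨fun h U hU => ?_, fun h U hU => ?_⟩
  · have := h U (mem_lieAlgOf_isotropy.2 hU)
    exact neg_eq_zero.2 this
  · exact neg_eq_zero.1 (h U (mem_lieAlgOf_isotropy.1 hU))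

/-- `ker σ ∩ 𝔥 ⊆ 𝔫`. -/
theorem IsCompactLagrangian.inf_le_normalizerL (hL : IsCompactLagrangian ξ d L) :
    tangentAlg L ⊓ lieAlgOf N (isotropy ξ) ≤ normalizerL ξ L := by
  rintro U ⟨hU, hU'⟩
  refine ⟨hU', fun X hX => ?_⟩
  have hUξ := mem_lieAlgOf_isotropy.1 hU'
  obtain ⟨h1, h2⟩ := mem_spaceL.1 hX
  refine mem_spaceL.2 ⟨mem_spaceM_iff.2 fun W hW => ?_, ?_⟩
  · rw [← ip_lie]
    refine mem_spaceM_iff.1 h1 _ ?_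
    rw [lie_lie, hUξ, hW, lie_zero, lie_zero, sub_zero]
  · have h3 := hL.lie_mem_tangentL hU hUξ h2
    rw [fundamentalField] at h3 ⊢
    rwa [lie_lie, hUξ, lie_zero, sub_zero]

theorem finrank_isotropy_add (ξ : LieAlg N G) : Module.finrank ℝ (tangentM ξ) +
    Module.finrank ℝ (lieAlgOf N (isotropy ξ)) = Module.finrank ℝ (LieAlg N G) := by
  have h : lieAlgOf N (isotropy ξ) = LinearMap.ker (LieAlgebra.ad ℝ (LieAlg N G) ξ) := by
    ext X
    rw [mem_lieAlgOf_isotropy, LinearMap.mem_ker, LieAlgebra.ad_apply, ← lie_skew, neg_eq_zero]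
  rw [h]
  exact LinearMap.finrank_range_add_finrank_ker _

/-- Rank-nullity for the evaluation at `ξ` on `ker σ`. -/
theorem finrank_tangentAlg : Module.finrank ℝ (tangentAlg L) =
    Module.finrank ℝ (LinearMap.range (evalTangent ξ L)) +
      Module.finrank ℝ ↥(tangentAlg L ⊓ lieAlgOf N (isotropy ξ)) := by
  have h : (LinearMap.ker (evalTangent ξ L)).map (tangentAlg L).subtype =
      tangentAlg L ⊓ lieAlgOf N (isotropy ξ) := by
    ext X
    simp only [Submodule.mem_map, LinearMap.mem_ker, evalTangent_apply, Submodule.subtype_apply,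
      Submodule.mem_inf, mem_lieAlgOf_isotropy]
    constructor
    · rintro ⟨Y, hY, rfl⟩
      exact ⟨Y.2, hY⟩
    · rintro ⟨h1, h2⟩
      exact ⟨⟨X, h1⟩, h2, rfl⟩
  rw [← h, Submodule.finrank_map_subtype_eq]
  exact (LinearMap.finrank_range_add_finrank_ker _).symm

/-- If `X^*` is tangent to `L`, the one-parameter subgroup generated by `X` lies in `K`. -/
theorem IsCompactLagrangian.exists_curve (hL : IsCompactLagrangian ξ d L) {X : LieAlg N G}
    (hX : X ∈ tangentAlg L) : ∃ γ : ℝ → G, (∀ t, γ t ∈ stabComponent L) ∧ HasVelocity γ X ∧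
      ∀ t, AdE (γ t) = NormedSpace.exp (t • adE X) := by
  obtain ⟨γ, hc, hγ, hexp⟩ := exists_oneParameter X
  refine ⟨γ, mem_stabComponent_of_curve hc hγ.1 fun t => mem_setStabilizer_iff.2 ⟨fun x hx => ?_,
    fun x hx => ?_⟩, hγ, hexp⟩
  · rw [← (coord (N := N) (G := G)).injective.mem_set_image, coord_Ad, hexp]
    exact hL.exp_mem hX (mem_image_of_mem _ hx) t
  · have h1 := hL.exp_mem hX (mem_image_of_mem coord hx) (-t)
    have h2 : AdE (γ t) (NormedSpace.exp ((-t) • adE X) (coord x)) = coord x := by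
      rw [hexp, ← exp_add_smul, add_neg_cancel, zero_smul, NormedSpace.exp_zero]
      rfl
    rw [← (coord (N := N) (G := G)).injective.mem_set_image, coord_Ad, ← h2,
      ← ContinuousLinearMap.comp_apply, ← AdE_mul, inv_mul_cancel, AdE_one]
    exact h1

theorem IsCompactLagrangian.tangentAlg_le (hL : IsCompactLagrangian ξ d L) :
    tangentAlg L ≤ lieAlgOf N (stabComponent L) := fun X hX => by
  obtain ⟨γ, h1, h2, -⟩ := hL.exists_curve hX
  exact ⟨γ, h1, h2⟩

/-! ### Transitivity of the identity component of the stabilizer -/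

/-- If the induced fields span a space of dimension `d` at `ξ`, the orbit of `ξ` under the identity
component of the stabilizer is a neighbourhood of `ξ` in `L`. -/
theorem IsCompactLagrangian.orbit_mem_nhdsWithin (hL : IsCompactLagrangian ξ d L) (hξ : ξ ∈ L)
    (hd : d ≤ Module.finrank ℝ (LinearMap.range (evalTangent ξ L))) :
    (fun k => AdE k (coord ξ)) '' (stabComponent L : Set G) ∈ 𝓝[coord '' L] (coord ξ) := by
  -- the map `X ↦ Ad (exp X) ξ` on `ker σ`, whose differential at `0` is the evaluation at `ξ`
  let V : Submodule ℝ 𝔼 := (tangentAlg L).map (coord (N := N) (G := G)).toLinearEquiv.toLinearMap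
  let F : 𝔼 →L[ℝ] (𝔼 →L[ℝ] 𝔼) := LinearMap.toContinuousLinearMap
    (adLin N G ∘ₗ (coord (N := N) (G := G)).symm.toLinearEquiv.toLinearMap)
  let P : V →L[ℝ] (𝔼 →L[ℝ] 𝔼) := F.comp V.subtypeL
  let g : V → 𝔼 := fun v => NormedSpace.exp (P v) (coord ξ)
  let ev : (𝔼 →L[ℝ] 𝔼) →L[ℝ] 𝔼 := ContinuousLinearMap.apply ℝ 𝔼 (coord ξ)
  have hg : HasStrictFDerivAt g (ev.comp P) 0 := by
    have h1 : HasStrictFDerivAt (𝕜 := ℝ) NormedSpace.exp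
        (1 : (𝔼 →L[ℝ] 𝔼) →L[ℝ] (𝔼 →L[ℝ] 𝔼)) (P 0) := by
      rw [map_zero]
      exact hasStrictFDerivAt_exp_zero
    exact ev.hasStrictFDerivAt.comp 0 (h1.comp 0 P.hasStrictFDerivAt)
  have hrep : ∀ v : V, ∃ k ∈ stabComponent L, g v = AdE k (coord ξ) := by
    rintro ⟨_, X, hX, rfl⟩
    obtain ⟨γ, hγ, -, hexp⟩ := hL.exists_curve hX
    refine ⟨γ 1, hγ 1, ?_⟩
    rw [hexp, one_smul]
    rfl
  have hgL : ∀ v, g v ∈ coord '' L := fun v => by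
    obtain ⟨k, hk, h⟩ := hrep v
    rw [h, ← coord_Ad]
    exact mem_image_of_mem _ (Ad_mem_of_mem_stabComponent hk hξ)
  have hrank : d ≤ Module.finrank ℝ (LinearMap.range (ev.comp P).toLinearMap) := by
    have h1 : (LinearMap.range (evalTangent ξ L)).map
        (coord (N := N) (G := G)).toLinearEquiv.toLinearMap =
          LinearMap.range (ev.comp P).toLinearMap := by
      ext w
      constructor
      · rintro ⟨_, ⟨X, rfl⟩, rfl⟩
        refine ⟨⟨coord (X : LieAlg N G), X, X.2, rfl⟩, ?_⟩
        rw [evalTangent_apply]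
        exact adE_coord (X : LieAlg N G) ξ
      · rintro ⟨⟨_, X, hX, rfl⟩, rfl⟩
        refine ⟨_, ⟨⟨X, hX⟩, rfl⟩, ?_⟩
        rw [evalTangent_apply]
        exact (adE_coord X ξ).symm
    rw [← h1]
    exact hd.trans ((coord (N := N) (G := G)).toLinearEquiv.submoduleMap _).finrank_eq.le
  have hg0 : g 0 = coord ξ := by
    simp [g, NormedSpace.exp_zero]
  have h := hL.isSmoothSubmanifold.range_mem_nhdsWithin hg hgL hrank
  rw [hg0] at h
  refine mem_of_superset h ?_
  rintro _ ⟨v, rfl⟩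
  obtain ⟨k, hk, h⟩ := hrep v
  exact ⟨k, hk, h.symm⟩

/-- The orbit of `ξ` under `K` is open in `L`; it is compact, so it is all of `L` as soon as
`L` is connected. -/
theorem IsCompactLagrangian.exists_stabComponent_eq [CompactSpace G]
    (hL : IsCompactLagrangian ξ d L) (hξ : ξ ∈ L)
    (hd : d ≤ Module.finrank ℝ (LinearMap.range (evalTangent ξ L))) (hc : IsConnected L)
    {q : LieAlg N G} (hq : q ∈ L) : ∃ k ∈ stabComponent L, Ad k ξ = q := by
  set O : Set 𝔼 := (fun k => AdE k (coord ξ)) '' (stabComponent L : Set G) with hO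
  have hOc : IsClosed O :=
    ((isClosed_stabComponent hL.isClosed_coord_image).isCompact.image
      (continuous_AdE_apply _)).isClosed
  have hopen : ∀ x ∈ O, O ∈ 𝓝[coord '' L] x := by
    rintro _ ⟨k, hk, rfl⟩
    have h1 := hL.orbit_mem_nhdsWithin hξ hd
    have hk' : k⁻¹ ∈ stabComponent L := (stabComponent L).inv_mem hk
    have hback : AdE (N := N) k⁻¹ (AdE k (coord ξ)) = coord ξ := by
      rw [← ContinuousLinearMap.comp_apply, ← AdE_mul, inv_mul_cancel, AdE_one]
      rfl
    have h2 : Tendsto (fun x => AdE (N := N) k⁻¹ x) (𝓝[coord '' L] (AdE k (coord ξ)))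
        (𝓝[coord '' L] (coord ξ)) := by
      refine tendsto_nhdsWithin_iff.2 ⟨?_, ?_⟩
      · have h3 := (AdE (N := N) k⁻¹).continuous.tendsto (AdE k (coord ξ))
        rw [hback] at h3
        exact h3.mono_left nhdsWithin_le_nhds
      · filter_upwards [self_mem_nhdsWithin] with x hx
        obtain ⟨y, hy, rfl⟩ := hx
        exact mem_image_of_mem coord (Ad_mem_of_mem_stabComponent hk' hy)
    filter_upwards [h2 h1] with x hx
    obtain ⟨j, hj, hjx⟩ := hx
    refine ⟨k * j, (stabComponent L).mul_mem hk hj, ?_⟩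
    dsimp only at hjx ⊢
    rw [AdE_mul, ContinuousLinearMap.comp_apply, hjx, ← ContinuousLinearMap.comp_apply, ← AdE_mul,
      mul_inv_cancel, AdE_one]
    rfl
  have hconn : IsPreconnected (coord '' L) :=
    hc.isPreconnected.image _ (coord (N := N) (G := G)).continuous.continuousOn
  have : PreconnectedSpace (coord '' L) := isPreconnected_iff_preconnectedSpace.1 hconn
  have hclopen : IsClopen ((Subtype.val : coord '' L → 𝔼) ⁻¹' O) := by
    refine ⟨hOc.preimage continuous_subtype_val, isOpen_iff_mem_nhds.2 fun x hx => ?_⟩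
    rw [nhds_subtype_eq_comap_nhdsWithin]
    exact preimage_mem_comap (hopen x hx)
  have huniv := hclopen.eq_univ ⟨⟨coord ξ, mem_image_of_mem _ hξ⟩, 1, one_mem _, by simp [AdE_one]⟩
  obtain ⟨k, hk, hkq⟩ := eq_univ_iff_forall.1 huniv ⟨coord q, mem_image_of_mem _ hq⟩
  exact ⟨k, hk, (coord (N := N) (G := G)).injective hkq⟩

end Stabilizer

end FlagLagrangian

end

theorem mainTheorem4 {N : ℕ} {G : Type*} [TopologicalSpace G]
    [ChartedSpace (EuclideanSpace ℝ (Fin N)) G] [Group G] [LieGroup (𝓡 N) ∞ G]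
    [T2Space G] [CompactSpace G] [ConnectedSpace G]
    [LieAlgebra.HasTrivialRadical ℝ (FlagLagrangian.LieAlg N G)]
    (ξ : FlagLagrangian.LieAlg N G) (d : ℕ) (L : Set (FlagLagrangian.LieAlg N G))
    (hL : FlagLagrangian.IsCompactLagrangian ξ d L) (hξ : ξ ∈ L) :
    (Module.finrank ℝ (FlagLagrangian.spaceV L) : ℤ) ≥
        (d : ℤ) + Module.finrank ℝ (FlagLagrangian.lieAlgOf N (FlagLagrangian.isotropy ξ))
          - Module.finrank ℝ (FlagLagrangian.normalizerL ξ L) ∧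
      ((Module.finrank ℝ (FlagLagrangian.spaceV L) : ℤ) =
          (d : ℤ) + Module.finrank ℝ (FlagLagrangian.lieAlgOf N (FlagLagrangian.isotropy ξ))
            - Module.finrank ℝ (FlagLagrangian.normalizerL ξ L) →
        (IsConnected L → ∀ q ∈ L, ∀ q' ∈ L, ∃ k ∈ FlagLagrangian.stabComponent L,
          FlagLagrangian.Ad k q = q') ∧
        FlagLagrangian.normalizerL ξ L ≤
          FlagLagrangian.lieAlgOf N (FlagLagrangian.stabComponent L) ⊓
            FlagLagrangian.lieAlgOf N (FlagLagrangian.isotropy ξ)) := by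
  have hV := FlagLagrangian.finrank_spaceV_add hL.subset
  have hH := FlagLagrangian.finrank_isotropy_add ξ
  rw [hL.finrank_eq ξ hξ] at hH
  have hk := FlagLagrangian.finrank_tangentAlg (ξ := ξ) (L := L)
  have he := hL.finrank_range_evalTangent_le hξ
  have hle := hL.inf_le_normalizerL
  have hn := Submodule.finrank_mono hle
  refine ⟨by omega, fun heq => ⟨fun hc q hq q' hq' => ?_, ?_⟩⟩
  · obtain ⟨k, hk1, hk2⟩ := hL.exists_stabComponent_eq hξ (by omega) hc hq
    obtain ⟨j, hj1, hj2⟩ := hL.exists_stabComponent_eq hξ (by omega) hc hq'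
    refine ⟨j * k⁻¹, mul_mem hj1 (inv_mem hk1), ?_⟩
    rw [← hk2, ← FlagLagrangian.Ad_mul, inv_mul_cancel_right, hj2]
  · rw [← Submodule.eq_of_le_of_finrank_eq hle (by omega)]
    exact inf_le_inf_right _ hL.tangentAlg_le
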